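/- Let $(\mathcal E,\langle\cdot,\cdot\rangle_{\mathcal E})$ be a finite-dimensional Euclidean space and let $\mathcal M\subset\mathcal E$ be a smoothly (not necessarily isometrically) embedded Riemannian manifold; $T_x\mathcal M$ is identified with a subspace of $\mathcal E$, and vector fields on $\mathcal M$ with $\mathcal E$-valued functions. Let $\mathsf g:\mathcal M\to\mathfrak L(\mathcal E,\mathcal E)$ be a metric operator: $\mathsf g$ is smooth, each $\mathsf g_x$ is positive-definite (in particular symmetric), and the Riemannian metric of $\mathcal M$ at $x$ is $\langle\xi,\mathsf g_x\eta\rangle_{\mathcal E}$ for $\xi,\eta\in T_x\mathcal M$. Let $\Pi_x$ be the projection of $\mathcal E$ to $T_x\mathcal M$ orthogonal for the inner product $\langle\omega_1,\mathsf g_x\omega_2\rangle_{\mathcal E}$, let $I$ be the identity of $\mathcal E$, let $\mathrm D_\xi$ denote the directional derivative of scalar-, vector- or operator-valued functions on $\mathcal M$, and let $\nabla$ be the Levi-Civita connection of $\mathcal M$. A Christoffel function is a smooth function $\Gamma$ from $\mathcal M$ to the $\mathcal E$-valued bilinear maps on $\mathcal E$ such that $\nabla_XY=\mathrm D_XY+\Gamma(X,Y)$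 for all vector fields $X,Y$ on $\mathcal M$. The curvature of $\mathcal M$ is $R^{\mathcal M}_{X,Y}Z=\nabla_{[X,Y]}Z-\nabla_X\nabla_YZ+\nabla_Y\nabla_XZ$. Let $\Gamma^{\mathcal E}$ be a smooth function from $\mathcal M$ to the $\mathcal E$-valued bilinear maps on $\mathcal E$ such that for all $x\in\mathcal M$, $\xi,\eta\in T_x\mathcal M$ and $\omega\in\mathcal E$, $\Gamma^{\mathcal E}(\xi,\eta)_x=\Gamma^{\mathcal E}(\eta,\xi)_x$ and $$\langle\eta,(\mathrm D_\xi\mathsf g)_x\omega\rangle_{\mathcal E}=\langle\Gamma^{\mathcal E}(\xi,\eta)_x,\mathsf g_x\omega\rangle_{\mathcal E}+\langle\eta,\mathsf g_x\Gamma^{\mathcal E}(\xi,\omega)_x\rangle_{\mathcal E}.$$ For a vector field $X$ on $\mathcal M$ and a function $s:\mathcal M\to\mathcal E$ define the connection $\nabla^{\mathcal E}_Xs=\mathrm D_Xs+\Gamma^{\mathcal E}(X,s)$ on $\mathcal M\times\mathcal E$. For $\xi,\eta,\varphi\in T_x\mathcal M$ and $\omega\in\mathcal E$ set $$\Gamma(\xi,\omega)=-(\mathrm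 D_\xi\Pi)\omega+\Pi\Gamma^{\mathcal E}(\xi,\omega),\qquad \mathrm{II}(\xi,\eta)=\Gamma^{\mathcal E}(\xi,\eta)-\Gamma(\xi,\eta),$$ $$R^{\mathcal E}_{\xi,\eta}\varphi=-(\mathrm D_\xi\Gamma^{\mathcal E})(\eta,\varphi)+(\mathrm D_\eta\Gamma^{\mathcal E})(\xi,\varphi)-\Gamma^{\mathcal E}(\xi,\Gamma^{\mathcal E}(\eta,\varphi))+\Gamma^{\mathcal E}(\eta,\Gamma^{\mathcal E}(\xi,\varphi)),$$ and let $\mathrm{II}^\dagger_\xi=\mathrm{II}^\dagger(\xi,\cdot):\mathcal E\to T_x\mathcal M$ be the adjoint of $\mathrm{II}_\xi=\mathrm{II}(\xi,\cdot):T_x\mathcal M\to\mathcal E$ for the inner products induced by $\mathsf g_x$. Then: 1. For vector fields $X,Y$ on $\mathcal M$ and $s:\mathcal M\to\mathcal E$: $\nabla^{\mathcal E}_XY-\nabla^{\mathcal E}_YX=[X,Y]$ and $\mathrm D_X\langle Y,\mathsf gs\rangle_{\mathcal E}=\langle\nabla^{\mathcal E}_XY,\mathsf gs\rangle_{\mathcal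 E}+\langle Y,\mathsf g\nabla^{\mathcal E}_Xs\rangle_{\mathcal E}$. 2. The Levi-Civita connection $\nabla$ exists, $\Gamma$ extends to a Christoffel function, and $\nabla_XY=\mathrm D_XY-(\mathrm D_X\Pi)Y+\Pi\Gamma^{\mathcal E}(X,Y)$ for vector fields $X,Y$ on $\mathcal M$. 3. $\mathrm{II}(\xi,\eta)=(\mathrm D_\xi\Pi)\eta+(I-\Pi)\Gamma^{\mathcal E}(\xi,\eta)$, $\mathrm{II}(\xi,\eta)=\mathrm{II}(\eta,\xi)$ and $\Pi\,\mathrm{II}(\xi,\eta)=0$. 4. $\mathrm{II}^\dagger_\xi\omega=(\mathrm D_\xi\Pi)(I-\Pi)\omega-\Pi\Gamma^{\mathcal E}(\xi,(I-\Pi)\omega)=-\Gamma(\xi,(I-\Pi)\omega)$. 5. (Gauss–Codazzi) $R^{\mathcal M}_{\xi,\eta}\varphi=\Pi R^{\mathcal E}_{\xi,\eta}\varphi+\mathrm{II}^\dagger(\eta,\mathrm{II}(\xi,\varphi))-\mathrm{II}^\dagger(\xi,\mathrm{II}(\eta,\varphi))$. -/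

import Mathlib

open scoped Manifold ContDiff Bundle
open Bundle

noncomputable section

namespace EmbeddedAmbient

section Projection

variable {E : Type*} [NormedAddCommGroup E] [InnerProductSpace ℝ E] [FiniteDimensional ℝ E]

/-- An operator `G` of a Euclidean space is positive-definite: it is symmetric and
`⟪w, G w⟫ > 0` for `w ≠ 0`. -/
structure IsPosDef (G : E →L[ℝ] E) : Prop where
  symm : ∀ v w : E, inner ℝ (G v) w = inner ℝ v (G w)
  pos : ∀ w : E, w ≠ 0 → 0 < inner ℝ w (G w)

/-- The projection of `E` to the subspace `T` that is orthogonal for the inner product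
`⟪v, G w⟫`, given by `N (Nᵀ G N)⁻¹ Nᵀ G` with `N : T → E` the inclusion, whose adjoint `Nᵀ` is
the orthogonal projection to `T`. See `metricProj_mem` and `inner_metricProj`. -/
def metricProj (T : Submodule ℝ E) (G : E →L[ℝ] E) : E →L[ℝ] E :=
  T.subtypeL ∘L (T.orthogonalProjectionOnto ∘L G ∘L T.subtypeL).inverse ∘L
    T.orthogonalProjectionOnto ∘L G

theorem metricProj_mem (T : Submodule ℝ E) (G : E →L[ℝ] E) (w : E) : metricProj T G w ∈ T := by
  simp [metricProj]

theorem inner_metricProj (T : Submodule ℝ E) {G : E →L[ℝ] E} (hG : IsPosDef G) (w : E) {η : E}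
    (hη : η ∈ T) : inner ℝ (metricProj T G w) (G η) = inner ℝ w (G η) := by
  set A : T →L[ℝ] T := T.orthogonalProjectionOnto ∘L G ∘L T.subtypeL with hA
  have hinj : Function.Injective A := by
    rw [injective_iff_map_eq_zero]
    intro v hv
    by_contra hne
    have h1 : inner ℝ (v : E) (G v) = 0 := by
      have h2 : inner ℝ v (A v) = inner ℝ (v : E) (G v) := by
        rw [hA]; exact Submodule.inner_orthogonalProjectionOnto_eq_of_mem_left v (G v)
      rw [← h2, hv, inner_zero_right]
    exact (hG.pos v (by simpa using hne)).ne' h1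
  let e : T ≃L[ℝ] T := (LinearEquiv.ofInjectiveEndo (A : T →ₗ[ℝ] T) hinj).toContinuousLinearEquiv
  have he : (e : T →L[ℝ] T) = A := by ext v; rfl
  have hinv : ∀ v, A (A.inverse v) = v := by
    intro v
    rw [← he, ContinuousLinearMap.inverse_equiv]
    exact e.apply_symm_apply v
  have h3 := hinv (T.orthogonalProjectionOnto (G w))
  set u : T := A.inverse (T.orthogonalProjectionOnto (G w)) with hu
  have h4 : metricProj T G w = u := by rfl
  rw [h4, ← hG.symm, ← hG.symm]
  have h5 := congrArg (fun v : T ↦ inner ℝ v (⟨η, hη⟩ : T)) h3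
  have h6 : inner ℝ (A u) (⟨η, hη⟩ : T) = inner ℝ (G u) η :=
    Submodule.inner_orthogonalProjectionOnto_eq_of_mem_right ⟨η, hη⟩ (G u)
  have h7 : inner ℝ (T.orthogonalProjectionOnto (G w)) (⟨η, hη⟩ : T) = inner ℝ (G w) η :=
    Submodule.inner_orthogonalProjectionOnto_eq_of_mem_right ⟨η, hη⟩ (G w)
  rw [← h6, ← h7]
  exact h5

end Projection

variable (F : Type*) [NormedAddCommGroup F] [NormedSpace ℝ F]
  {M : Type*} [TopologicalSpace M] [ChartedSpace F M]
  {E : Type*} [NormedAddCommGroup E] [InnerProductSpace ℝ E]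

/-- The identification of the tangent space `T_x M` with a subspace of `E`: the differential of the
embedding `ι : M → E`. -/
def tangentIncl (ι : M → E) (x : M) : TangentSpace 𝓘(ℝ, F) x →L[ℝ] E :=
  mvfderiv 𝓘(ℝ, F) ι x

/-- A tangent vector field regarded as an `E`-valued function. -/
def fieldIncl (ι : M → E) (Y : Π x : M, TangentSpace 𝓘(ℝ, F) x) : M → E :=
  fun x ↦ tangentIncl F ι x (Y x)

/-- `(M, g, E)` is an embedded ambient structure: `ι` embeds the Riemannian manifold `M` smoothly
(not necessarily isometrically) in `E`, and `g` is a metric operator, a smooth family of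
positive-definite operators of `E` that induces the Riemannian metric of `M`. -/
structure IsAmbientStructure [RiemannianBundle (fun x : M ↦ TangentSpace 𝓘(ℝ, F) x)]
    (ι : M → E) (g : M → E →L[ℝ] E) : Prop where
  embedding : Manifold.IsSmoothEmbedding 𝓘(ℝ, F) 𝓘(ℝ, E) ∞ ι
  smooth : ContMDiff 𝓘(ℝ, F) 𝓘(ℝ, E →L[ℝ] E) ∞ g
  posDef : ∀ x, IsPosDef (g x)
  metric : ∀ (x : M) (ξ η : TangentSpace 𝓘(ℝ, F) x),
    inner ℝ ξ η = inner ℝ (tangentIncl F ι x ξ) (g x (tangentIncl F ι x η))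

/-- The operator-valued function `Π`: at `x`, the `g_x`-orthogonal projection of `E` to `T_x M`. -/
def proj [FiniteDimensional ℝ E] (ι : M → E) (g : M → E →L[ℝ] E) (x : M) : E →L[ℝ] E :=
  metricProj (tangentIncl F ι x).range (g x)

/-- `∇` is the Levi-Civita connection of the Riemannian manifold `M`: torsion-free and compatible
with the metric, `X⟪Y, Z⟫ = ⟪∇_X Y, Z⟫ + ⟪Y, ∇_X Z⟫`. (`nabla Y x (X x)` is `(∇_X Y)_x`.) -/
structure IsLeviCivita [FiniteDimensional ℝ F] [IsManifold 𝓘(ℝ, F) ∞ M]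
    [RiemannianBundle (fun x : M ↦ TangentSpace 𝓘(ℝ, F) x)]
    (nabla : CovariantDerivative 𝓘(ℝ, F) F (fun x : M ↦ TangentSpace 𝓘(ℝ, F) x)) : Prop where
  torsion_eq_zero : nabla.torsion = 0
  metric : ∀ (X Y Z : Π x : M, TangentSpace 𝓘(ℝ, F) x) (x : M),
    MDiffAt (T% Y) x → MDiffAt (T% Z) x →
      mvfderiv 𝓘(ℝ, F) (fun y ↦ (inner ℝ (Y y) (Z y) : ℝ)) x (X x) =
        inner ℝ (nabla Y x (X x)) (Z x) + inner ℝ (Y x) (nabla Z x (X x))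

/-- A Christoffel function of the ambient structure, for the Levi-Civita connection `∇` of `M`: a
smooth function `Γ` to the `E`-valued bilinear maps on `E` with
`(∇_X Y)_x = (D_X Y)_x + Γ(X_x, Y_x)_x` for all vector fields `X`, `Y` on `M`. -/
structure IsChristoffelFunction [IsManifold 𝓘(ℝ, F) ∞ M] (ι : M → E)
    (nabla : CovariantDerivative 𝓘(ℝ, F) F (fun x : M ↦ TangentSpace 𝓘(ℝ, F) x))
    (Γ : M → E →L[ℝ] E →L[ℝ] E) : Prop where
  smooth : ContMDiff 𝓘(ℝ, F) 𝓘(ℝ, E →L[ℝ] E →L[ℝ] E) ∞ Γ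
  eq : ∀ (X Y : Π x : M, TangentSpace 𝓘(ℝ, F) x) (x : M), MDiffAt (T% Y) x →
    tangentIncl F ι x (nabla Y x (X x)) =
      mvfderiv 𝓘(ℝ, F) (fieldIncl F ι Y) x (X x) +
        Γ x (tangentIncl F ι x (X x)) (tangentIncl F ι x (Y x))

/-- The Riemannian curvature, with the sign convention
`R_{X,Y} Z = ∇_{[X,Y]} Z - ∇_X ∇_Y Z + ∇_Y ∇_X Z`. -/
def curvature [IsManifold 𝓘(ℝ, F) ∞ M]
    (nabla : CovariantDerivative 𝓘(ℝ, F) F (fun x : M ↦ TangentSpace 𝓘(ℝ, F) x))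
    (X Y Z : Π x : M, TangentSpace 𝓘(ℝ, F) x) (x : M) : TangentSpace 𝓘(ℝ, F) x :=
  nabla Z x (VectorField.mlieBracket 𝓘(ℝ, F) X Y x)
    - nabla (fun y ↦ nabla Z y (Y y)) x (X x)
    + nabla (fun y ↦ nabla Z y (X y)) x (Y x)

/-- The connection `∇^E_X s = D_X s + Γ^E(X, s)` on the trivial bundle `M × E`. -/
def ambientConnection (ι : M → E) (ΓE : M → E →L[ℝ] E →L[ℝ] E) :
    CovariantDerivative 𝓘(ℝ, F) E (Bundle.Trivial M E) where
  toFun s x := (mvfderiv 𝓘(ℝ, F) (fun y ↦ (s y : E)) x : TangentSpace 𝓘(ℝ, F) x →L[ℝ] E) +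
    (ΓE x).flip (s x) ∘L tangentIncl F ι x
  isCovariantDerivativeOnUniv := by
    refine ⟨fun {s t x} hs ht _ ↦ ?_, fun {s f x} hs hf _ ↦ ?_⟩
    · rw [mdifferentiableAt_section] at hs ht
      have h := mvfderiv_add (I := 𝓘(ℝ, F)) (g := (s : M → E)) (g' := (t : M → E)) hs ht
      ext v
      have h' := congrArg (fun L : TangentSpace 𝓘(ℝ, F) x →L[ℝ] E ↦ L v) h
      simp only [add_apply] at h'
      change mvfderiv 𝓘(ℝ, F) ((s : M → E) + (t : M → E)) x v
          + ΓE x (tangentIncl F ι x v) (s x + t x)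
        = (mvfderiv 𝓘(ℝ, F) (s : M → E) x v + ΓE x (tangentIncl F ι x v) (s x))
          + (mvfderiv 𝓘(ℝ, F) (t : M → E) x v + ΓE x (tangentIncl F ι x v) (t x))
      rw [h', map_add]
      abel
    · rw [mdifferentiableAt_section] at hs
      have h := mvfderiv_smul (I := 𝓘(ℝ, F)) hf (g := (s : M → E)) hs
      ext v
      have h' := congrArg (fun L : TangentSpace 𝓘(ℝ, F) x →L[ℝ] E ↦ L v) h
      change mvfderiv 𝓘(ℝ, F) (f • (s : M → E)) x v = f x • mvfderiv 𝓘(ℝ, F) (s : M → E) x v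
        + mvfderiv 𝓘(ℝ, F) f x v • s x at h'
      change mvfderiv 𝓘(ℝ, F) (f • (s : M → E)) x v
          + ΓE x (tangentIncl F ι x v) (f x • s x)
        = f x • (mvfderiv 𝓘(ℝ, F) (s : M → E) x v + ΓE x (tangentIncl F ι x v) (s x))
          + mvfderiv 𝓘(ℝ, F) f x v • s x
      rw [h', map_smul, smul_add]
      exact add_right_comm _ _ _

theorem ambientConnection_apply (ι : M → E) (ΓE : M → E →L[ℝ] E →L[ℝ] E) (s : M → E) (x : M)
    (ξ : TangentSpace 𝓘(ℝ, F) x) :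
    ambientConnection F ι ΓE s x ξ =
      mvfderiv 𝓘(ℝ, F) s x ξ + ΓE x (tangentIncl F ι x ξ) (s x) := rfl

/-- `Γ(ξ, ·) = -(D_ξ Π) + Π Γ^E(ξ, ·)` for a tangent vector `ξ`. -/
def tangentChristoffel [FiniteDimensional ℝ E] (ι : M → E) (g : M → E →L[ℝ] E) (ΓE : M → E →L[ℝ] E →L[ℝ] E) (x : M)
    (ξ : TangentSpace 𝓘(ℝ, F) x) : E →L[ℝ] E :=
  -mvfderiv 𝓘(ℝ, F) (proj F ι g) x ξ + proj F ι g x ∘L ΓE x (tangentIncl F ι x ξ)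

/-- The second fundamental form `II_ξ : η ↦ Γ^E(ξ, η) - Γ(ξ, η)`, a linear map from `T_x M`
to `E`. -/
def secondForm [FiniteDimensional ℝ E] (ι : M → E) (g : M → E →L[ℝ] E) (ΓE : M → E →L[ℝ] E →L[ℝ] E) (x : M)
    (ξ : TangentSpace 𝓘(ℝ, F) x) : TangentSpace 𝓘(ℝ, F) x →L[ℝ] E :=
  (ΓE x (tangentIncl F ι x ξ) - tangentChristoffel F ι g ΓE x ξ) ∘L tangentIncl F ι x

/-- The adjoint `II_ξ† : E → T_x M` of `II_ξ` for the Riemannian inner product of `T_x M` and the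
inner product `⟪v, g_x w⟫` of `E`. See `inner_secondFormAdjoint`. -/
def secondFormAdjoint [FiniteDimensional ℝ F] [FiniteDimensional ℝ E]
    [RiemannianBundle (fun x : M ↦ TangentSpace 𝓘(ℝ, F) x)]
    (ι : M → E) (g : M → E →L[ℝ] E) (ΓE : M → E →L[ℝ] E →L[ℝ] E) (x : M)
    (ξ : TangentSpace 𝓘(ℝ, F) x) : E →ₗ[ℝ] TangentSpace 𝓘(ℝ, F) x :=
  haveI : FiniteDimensional ℝ (TangentSpace 𝓘(ℝ, F) x) := inferInstanceAs (FiniteDimensional ℝ F)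
  LinearMap.adjoint (secondForm F ι g ΓE x ξ : TangentSpace 𝓘(ℝ, F) x →ₗ[ℝ] E) ∘ₗ (g x : E →ₗ[ℝ] E)

theorem inner_secondFormAdjoint [FiniteDimensional ℝ F] [FiniteDimensional ℝ E]
    [RiemannianBundle (fun x : M ↦ TangentSpace 𝓘(ℝ, F) x)]
    (ι : M → E) (g : M → E →L[ℝ] E) (ΓE : M → E →L[ℝ] E →L[ℝ] E) (x : M)
    (ξ η : TangentSpace 𝓘(ℝ, F) x) (w : E) :
    inner ℝ η (secondFormAdjoint F ι g ΓE x ξ w) =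
      inner ℝ (secondForm F ι g ΓE x ξ η) (g x w) := by
  simp [secondFormAdjoint, LinearMap.adjoint_inner_right]

/-- `R^E_{ξ,η} φ = -(D_ξ Γ^E)(η, φ) + (D_η Γ^E)(ξ, φ) - Γ^E(ξ, Γ^E(η, φ)) + Γ^E(η, Γ^E(ξ, φ))`. -/
def ambientCurvature (ι : M → E) (ΓE : M → E →L[ℝ] E →L[ℝ] E) (x : M)
    (ξ η φ : TangentSpace 𝓘(ℝ, F) x) : E :=
  let i := tangentIncl F ι x;
  -mvfderiv 𝓘(ℝ, F) ΓE x ξ (i η) (i φ) + mvfderiv 𝓘(ℝ, F) ΓE x η (i ξ) (i φ)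
    - ΓE x (i ξ) (ΓE x (i η) (i φ)) + ΓE x (i η) (ΓE x (i ξ) (i φ))

end EmbeddedAmbient
end

namespace EmbeddedAmbient

open scoped Topology

/-! ### Leibniz and chain rules for directional derivatives of vector-valued functions -/

section Calculus

variable {F : Type*} [NormedAddCommGroup F] [NormedSpace ℝ F]
  {M : Type*} [TopologicalSpace M] [ChartedSpace F M]
  {V₁ V₂ V₃ : Type*} [NormedAddCommGroup V₁] [NormedSpace ℝ V₁] [NormedAddCommGroup V₂]
  [NormedSpace ℝ V₂] [NormedAddCommGroup V₃] [NormedSpace ℝ V₃]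

/-! The tangent bundle is treated as a subbundle of `M × E`, and the Levi-Civita connection is
obtained by projecting the ambient connection: `∇_X Y = Π ∇^E_X Y`. Symmetry of `Γ^E` on tangent
vectors and equality of mixed second derivatives make `∇^E` torsion-free on tangent fields
(`tangentIncl_mlieBracket`, `ambientConnection_torsion`). The metric identity for `Γ^E` is the
Leibniz rule for `⟪Y, g s⟫`. Both properties survive the projection because `Π` fixes tangent
vectors and is `g`-symmetric (`exists_isLeviCivita`). The Koszul-type symmetry argument gives
uniqueness (`IsLeviCivita.eq`).

Calculus on `M` is reduced to calculus in `E` by a local retraction `r` of the immersion: near `x`,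
`D_ξ f` is the Fréchet derivative of `f ∘ r` in the direction `dι ξ`. This gives smoothness of
derivatives. Also `d(ι ∘ r)` is a smooth family of projections to the tangent spaces, from which `Π`
is computed smoothly (`proj_contMDiff`).

The algebra comes from three differentiated identities. `Π² = Π` shows that `D_ξ Π` exchanges
tangent and normal vectors; `Π Y = Y` gives the formula for `∇` and the Gauss formula; `⟪Π v, g w⟫ =
⟪v, g Π w⟫` gives the adjoint of `II` (`inner_secondForm`).

For Gauss–Codazzi, put `S = ∇^E_Y Z`, so that `∇_Y Z = Π S` and `S - Π S = II(Y, Z)`.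
Differentiating `Π S` shows that `∇_X ∇_Y Z` is `Π ∇^E_X S + II†(X, II(Y, Z))`
(`tangentIncl_leviCivita_leviCivita`). Antisymmetrizing leaves `Π` of the curvature of `∇^E` and the
two `II†` terms. -/

theorem hasMFDerivAt_bilinear (B : V₁ →L[ℝ] V₂ →L[ℝ] V₃) {f : M → V₁} {h : M → V₂} {x : M}
    (hf : MDifferentiableAt 𝓘(ℝ, F) 𝓘(ℝ, V₁) f x)
    (hh : MDifferentiableAt 𝓘(ℝ, F) 𝓘(ℝ, V₂) h x) :
    HasMFDerivAt 𝓘(ℝ, F) 𝓘(ℝ, V₃) (fun y ↦ B (f y) (h y)) x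
      (B.precompR F (f x) (mvfderiv 𝓘(ℝ, F) h x : F →L[ℝ] V₂) +
        B.precompL F (mvfderiv 𝓘(ℝ, F) f x : F →L[ℝ] V₁) (h x) : F →L[ℝ] V₃) := by
  refine ⟨B.isBoundedBilinearMap.continuous.continuousAt.comp
    (hf.continuousAt.prodMk hh.continuousAt), ?_⟩
  convert! B.hasFDerivWithinAt_of_bilinear hf.hasMFDerivAt.2 hh.hasMFDerivAt.2
  simp only [writtenInExtChartAt, mfld_simps]
  rfl

/-- Source of the product rules for evaluation of operators and for inner products, by the choice of
`B`. -/
theorem mvfderiv_bilinear (B : V₁ →L[ℝ] V₂ →L[ℝ] V₃) {f : M → V₁} {h : M → V₂} {x : M}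
    (hf : MDifferentiableAt 𝓘(ℝ, F) 𝓘(ℝ, V₁) f x) (hh : MDifferentiableAt 𝓘(ℝ, F) 𝓘(ℝ, V₂) h x)
    (ξ : TangentSpace 𝓘(ℝ, F) x) :
    mvfderiv 𝓘(ℝ, F) (fun y ↦ B (f y) (h y)) x ξ =
      B (mvfderiv 𝓘(ℝ, F) f x ξ) (h x) + B (f x) (mvfderiv 𝓘(ℝ, F) h x ξ) := by
  have h2 := congrArg (fun L : TangentSpace 𝓘(ℝ, F) x →L[ℝ] V₃ ↦ L ξ)
    (hasMFDerivAt_bilinear B hf hh).mfderiv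
  change mvfderiv 𝓘(ℝ, F) (fun y ↦ B (f y) (h y)) x ξ =
    B (f x) (mvfderiv 𝓘(ℝ, F) h x ξ) + B (mvfderiv 𝓘(ℝ, F) f x ξ) (h x) at h2
  rw [h2, add_comm]

theorem mdifferentiableAt_bilinear (B : V₁ →L[ℝ] V₂ →L[ℝ] V₃) {f : M → V₁} {h : M → V₂} {x : M}
    (hf : MDifferentiableAt 𝓘(ℝ, F) 𝓘(ℝ, V₁) f x)
    (hh : MDifferentiableAt 𝓘(ℝ, F) 𝓘(ℝ, V₂) h x) :
    MDifferentiableAt 𝓘(ℝ, F) 𝓘(ℝ, V₃) (fun y ↦ B (f y) (h y)) x :=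
  (hasMFDerivAt_bilinear B hf hh).mdifferentiableAt

theorem mvfderiv_clm_apply {A : M → V₁ →L[ℝ] V₂} {h : M → V₁} {x : M}
    (hA : MDifferentiableAt 𝓘(ℝ, F) 𝓘(ℝ, V₁ →L[ℝ] V₂) A x)
    (hh : MDifferentiableAt 𝓘(ℝ, F) 𝓘(ℝ, V₁) h x) (ξ : TangentSpace 𝓘(ℝ, F) x) :
    mvfderiv 𝓘(ℝ, F) (fun y ↦ A y (h y)) x ξ =
      mvfderiv 𝓘(ℝ, F) A x ξ (h x) + A x (mvfderiv 𝓘(ℝ, F) h x ξ) :=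
  mvfderiv_bilinear (ContinuousLinearMap.id ℝ (V₁ →L[ℝ] V₂)) hA hh ξ

theorem mdifferentiableAt_clm_apply {A : M → V₁ →L[ℝ] V₂} {h : M → V₁} {x : M}
    (hA : MDifferentiableAt 𝓘(ℝ, F) 𝓘(ℝ, V₁ →L[ℝ] V₂) A x)
    (hh : MDifferentiableAt 𝓘(ℝ, F) 𝓘(ℝ, V₁) h x) :
    MDifferentiableAt 𝓘(ℝ, F) 𝓘(ℝ, V₂) (fun y ↦ A y (h y)) x :=
  mdifferentiableAt_bilinear (ContinuousLinearMap.id ℝ (V₁ →L[ℝ] V₂)) hA hh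

theorem mvfderiv_inner {V : Type*} [NormedAddCommGroup V] [InnerProductSpace ℝ V] {x : M}
    {s t : M → V} (hs : MDifferentiableAt 𝓘(ℝ, F) 𝓘(ℝ, V) s x)
    (ht : MDifferentiableAt 𝓘(ℝ, F) 𝓘(ℝ, V) t x) (ξ : TangentSpace 𝓘(ℝ, F) x) :
    mvfderiv 𝓘(ℝ, F) (fun y ↦ (inner ℝ (s y) (t y) : ℝ)) x ξ =
      inner ℝ (mvfderiv 𝓘(ℝ, F) s x ξ) (t x) + inner ℝ (s x) (mvfderiv 𝓘(ℝ, F) t x ξ) :=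
  mvfderiv_bilinear (innerSL ℝ) hs ht ξ

theorem mvfderiv_congr {f h : M → V₁} {x : M} (hfh : f =ᶠ[𝓝 x] h) :
    mvfderiv 𝓘(ℝ, F) f x = mvfderiv 𝓘(ℝ, F) h x := by
  ext v
  exact congrArg (fun L : TangentSpace 𝓘(ℝ, F) x →L[ℝ] V₁ ↦ L v) hfh.mfderiv_eq

/-- The chain rule for a map that factors, near `x`, through a map to a vector space. -/
theorem mvfderiv_comp_vec {f : V₁ → V₂} {h : M → V₁} {x : M} (hf : DifferentiableAt ℝ f (h x))
    (hh : MDifferentiableAt 𝓘(ℝ, F) 𝓘(ℝ, V₁) h x) (ξ : TangentSpace 𝓘(ℝ, F) x) :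
    mvfderiv 𝓘(ℝ, F) (fun y ↦ f (h y)) x ξ = fderiv ℝ f (h x) (mvfderiv 𝓘(ℝ, F) h x ξ) := by
  have h1 := mfderiv_comp_apply x hf.mdifferentiableAt hh ξ
  rw [mfderiv_eq_fderiv] at h1
  exact h1

theorem contMDiffAt_const_clm_apply {n : ℕ∞ω} (L : V₁ →L[ℝ] V₂) {f : M → V₁} {x : M}
    (hf : ContMDiffAt 𝓘(ℝ, F) 𝓘(ℝ, V₁) n f x) :
    ContMDiffAt 𝓘(ℝ, F) 𝓘(ℝ, V₂) n (fun y ↦ L (f y)) x :=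
  L.contDiff.contMDiff.contMDiffAt.comp x hf

end Calculus

/-! ### The `G`-orthogonal projection: characterization and a smooth formula -/

section MetricProjection

variable {E : Type*} [NormedAddCommGroup E] [InnerProductSpace ℝ E] [FiniteDimensional ℝ E]

/-- The difference of two candidates lies in `T` and is `G`-orthogonal to `T`, hence to itself. -/
theorem eq_metricProj {T : Submodule ℝ E} {G : E →L[ℝ] E} (hG : IsPosDef G) {u w : E} (hu : u ∈ T)
    (h : ∀ η ∈ T, inner ℝ u (G η) = inner ℝ w (G η)) : u = metricProj T G w := by
  set v := metricProj T G w with hv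
  have hvT : v ∈ T := metricProj_mem T G w
  by_contra hne
  have h1 := hG.pos (u - v) (sub_ne_zero.2 hne)
  rw [inner_sub_left, h _ (T.sub_mem hu hvT), hv,
    inner_metricProj T hG w (T.sub_mem hu hvT), sub_self] at h1
  exact h1.false

theorem metricProj_of_mem {T : Submodule ℝ E} {G : E →L[ℝ] E} (hG : IsPosDef G) {u : E}
    (hu : u ∈ T) : metricProj T G u = u :=
  (eq_metricProj hG hu fun _ _ ↦ rfl).symm

theorem metricProj_idem {T : Submodule ℝ E} {G : E →L[ℝ] E} (hG : IsPosDef G) (w : E) :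
    metricProj T G (metricProj T G w) = metricProj T G w :=
  metricProj_of_mem hG (metricProj_mem T G w)

/-- Both sides equal `⟪Π v, G Π w⟫`. -/
theorem inner_metricProj_left {T : Submodule ℝ E} {G : E →L[ℝ] E} (hG : IsPosDef G) (v w : E) :
    inner ℝ (metricProj T G v) (G w) = inner ℝ v (G (metricProj T G w)) := by
  rw [← inner_metricProj T hG v (metricProj_mem T G w), ← hG.symm, ← hG.symm, real_inner_comm,
    ← inner_metricProj T hG w (metricProj_mem T G v), real_inner_comm]

variable (E) in
/-- The adjoint of operators of a Euclidean space, as a continuous linear map. -/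
noncomputable def adjointL : (E →L[ℝ] E) →L[ℝ] (E →L[ℝ] E) :=
  haveI := FiniteDimensional.complete ℝ E
  LinearMap.toContinuousLinearMap
    { toFun := fun A ↦ ContinuousLinearMap.adjoint A
      map_add' := fun A B ↦ by simp
      map_smul' := fun c A ↦ by simp }

theorem inner_adjointL_left (A : E →L[ℝ] E) (v w : E) :
    inner ℝ (adjointL E A v) w = inner ℝ v (A w) :=
  haveI := FiniteDimensional.complete ℝ E
  ContinuousLinearMap.adjoint_inner_left A w v

/-- The positive-definite operator `Pᵀ G P + (I - P)ᵀ (I - P)`. -/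
noncomputable def gramOp (P G : E →L[ℝ] E) : E →L[ℝ] E :=
  adjointL E P ∘L G ∘L P + adjointL E (.id ℝ E - P) ∘L (.id ℝ E - P)

theorem inner_gramOp (P G : E →L[ℝ] E) (v w : E) :
    inner ℝ (gramOp P G v) w = inner ℝ (G (P v)) (P w) + inner ℝ (v - P v) (w - P w) := by
  simp only [gramOp, add_apply, ContinuousLinearMap.comp_apply, inner_add_left, inner_adjointL_left]
  simp

/-- The quadratic form is `⟪P v, G P v⟫ + ‖v - P v‖²`, which vanishes only if `P v = 0` and `v = P
v`; in finite dimension injectivity suffices. -/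
theorem gramOp_isInvertible (P : E →L[ℝ] E) {G : E →L[ℝ] E} (hG : IsPosDef G) :
    (gramOp P G).IsInvertible := by
  have hinj : Function.Injective (gramOp P G) := by
    rw [injective_iff_map_eq_zero]
    intro v hv
    have h1 := inner_gramOp P G v v
    rw [hv, inner_zero_left] at h1
    have h2 : 0 ≤ inner ℝ (v - P v) (v - P v) := real_inner_self_nonneg
    have h3 : P v = 0 := by
      by_contra hne
      have := hG.pos _ hne
      rw [real_inner_comm] at this
      linarith
    rw [h3] at h1
    simpa using h1.symm
  refine ⟨(LinearEquiv.ofInjectiveEndo (gramOp P G : E →ₗ[ℝ] E)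
    hinj).toContinuousLinearEquiv, ?_⟩
  ext v; rfl

/-- The `G`-orthogonal projection to the range of a projection `P`, by a formula that depends
smoothly on `P` and `G`. -/
theorem metricProj_eq_of_projection {T : Submodule ℝ E} {P G : E →L[ℝ] E} (hG : IsPosDef G)
    (hP : ∀ w, P w ∈ T) (hP' : ∀ w ∈ T, P w = w) :
    metricProj T G = P ∘L (gramOp P G).inverse ∘L adjointL E P ∘L G := by
  ext w
  refine (eq_metricProj hG (hP _) fun η hη ↦ ?_).symm
  set u := (gramOp P G).inverse (adjointL E P (G w)) with hu
  obtain ⟨e, he⟩ := gramOp_isInvertible P hG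
  have h1 : gramOp P G u = adjointL E P (G w) := by
    rw [hu, ← he, ContinuousLinearMap.inverse_equiv]
    exact e.apply_symm_apply _
  -- Since `P η = η`, the `(I - P)` term drops out. What remains says that `P u` and `w` have the
  -- same `G`-pairing with `T`.
  have h2 := inner_gramOp P G u η
  rw [h1, inner_adjointL_left, hP' η hη, sub_self, inner_zero_right, add_zero] at h2
  rw [← hG.symm, ← hG.symm, h2]
  rfl

end MetricProjection

/-! ### Local retractions of an immersion -/

section Retraction

variable {F : Type*} [NormedAddCommGroup F] [NormedSpace ℝ F]
  {M : Type*} [TopologicalSpace M] [ChartedSpace F M]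
  {E : Type*} [NormedAddCommGroup E] [NormedSpace ℝ E]

/-- An immersion has, near each point, a smooth left inverse. -/
theorem exists_local_retraction {ι : M → E} {x : M}
    (h : Manifold.IsImmersionAt 𝓘(ℝ, F) 𝓘(ℝ, E) ∞ ι x) :
    ∃ r : E → M, ContMDiffAt 𝓘(ℝ, E) 𝓘(ℝ, F) ∞ r (ι x) ∧ ∀ᶠ y in 𝓝 x, r (ι y) = y := by
  set φ := h.domChart
  set ψ := h.codChart
  -- In adapted charts the immersion is `u ↦ (u, 0)`, so the first component recovers the chart of
  -- `M`; `r` is this component read back in `M`.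
  have hloc : ∀ y ∈ φ.source, (h.equiv.symm (ψ.extend 𝓘(ℝ, E) (ι y))).1 = φ.extend 𝓘(ℝ, F) y := by
    intro y hy
    have hy' : y ∈ (φ.extend 𝓘(ℝ, F)).source := by simpa using hy
    have h1 := h.writtenInCharts ((φ.extend 𝓘(ℝ, F)).map_source hy')
    simp only [Function.comp_apply] at h1
    rw [(φ.extend 𝓘(ℝ, F)).left_inv hy'] at h1
    rw [h1]
    simp
  refine ⟨fun e ↦ (φ.extend 𝓘(ℝ, F)).symm (h.equiv.symm (ψ.extend 𝓘(ℝ, E) e)).1, ?_, ?_⟩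
  · have h1 : ContMDiffAt 𝓘(ℝ, E) 𝓘(ℝ, E) ∞ (ψ.extend 𝓘(ℝ, E)) (ι x) :=
      ψ.contMDiffAt_extend h.codChart_mem_maximalAtlas h.mem_codChart_source
    have h2 : ContMDiff 𝓘(ℝ, E) 𝓘(ℝ, F) ∞ (fun e ↦ (h.equiv.symm e).1) :=
      (contDiff_fst.comp h.equiv.symm.contDiff).contMDiff
    have h3 : ContMDiffAt 𝓘(ℝ, E) 𝓘(ℝ, F) ∞
      (fun e ↦ (h.equiv.symm (ψ.extend 𝓘(ℝ, E) e)).1) (ι x) := h2.contMDiffAt.comp _ h1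
    have h4 := contMDiffOn_extend_symm (I := 𝓘(ℝ, F)) h.domChart_mem_maximalAtlas
    refine ContMDiffAt.comp_of_eq (y := φ.extend 𝓘(ℝ, F) x) ?_ h3
      (hloc x h.mem_domChart_source)
    refine h4.contMDiffAt ?_
    simpa using φ.open_target.mem_nhds (φ.map_source h.mem_domChart_source)
  · filter_upwards [φ.open_source.mem_nhds h.mem_domChart_source] with y hy
    rw [hloc y hy]
    exact (φ.extend 𝓘(ℝ, F)).left_inv (by simpa using hy)

end Retraction

/-! ### Derivatives through a retraction, and smoothness of `Π` -/

section

variable {F : Type*} [NormedAddCommGroup F] [NormedSpace ℝ F]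
  {M : Type*} [TopologicalSpace M] [ChartedSpace F M]
  {E : Type*} [NormedAddCommGroup E] [InnerProductSpace ℝ E]
  {V : Type*} [NormedAddCommGroup V] [NormedSpace ℝ V]

variable (F) in
/-- `r` is, near `x`, a left inverse of `ι` that is `C^n` at `ι x`. -/
structure IsRetractionAt (n : ℕ∞ω) (ι : M → E) (r : E → M) (x : M) : Prop where
  embedding : ContMDiffAt 𝓘(ℝ, F) 𝓘(ℝ, E) n ι x
  smooth : ContMDiffAt 𝓘(ℝ, E) 𝓘(ℝ, F) n r (ι x)
  left_inv : ∀ᶠ y in 𝓝 x, r (ι y) = y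

theorem exists_isRetractionAt {ι : M → E} (hι : Manifold.IsImmersion 𝓘(ℝ, F) 𝓘(ℝ, E) ∞ ι) (x : M) :
    ∃ r : E → M, IsRetractionAt F ∞ ι r x := by
  obtain ⟨r, h1, h2⟩ := exists_local_retraction (hι.isImmersionAt x)
  exact ⟨r, hι.contMDiff.contMDiffAt, h1, h2⟩

variable (F) in
/-- The differential of a local retraction `r` of `ι`, as a map from `E` to `T_x M`. -/
noncomputable def retractionDeriv (ι : M → E) (r : E → M) (x : M) :
    E →L[ℝ] TangentSpace 𝓘(ℝ, F) x :=
  (mfderiv 𝓘(ℝ, E) 𝓘(ℝ, F) r (ι x) : E →L[ℝ] F)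

namespace IsRetractionAt

variable {ι : M → E} {r : E → M} {x : M} {n : ℕ∞ω}

theorem apply_self (h : IsRetractionAt F n ι r x) : r (ι x) = x := h.left_inv.self_of_nhds

theorem of_le {m : ℕ∞ω} (h : IsRetractionAt F n ι r x) (hmn : m ≤ n) : IsRetractionAt F m ι r x :=
  ⟨h.embedding.of_le hmn, h.smooth.of_le hmn, h.left_inv⟩

/-- Being `C^n` at a point passes to a neighbourhood when `n ≠ ∞`; at order `∞` the neighbourhood
may shrink with the order of differentiation. -/
theorem eventually [IsManifold 𝓘(ℝ, F) n M] (h : IsRetractionAt F n ι r x) (hn : n ≠ ∞) :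
    ∀ᶠ y in 𝓝 x, IsRetractionAt F n ι r y := by
  have h1 := (contMDiffAt_iff_contMDiffAt_nhds hn).1 h.smooth
  filter_upwards [(contMDiffAt_iff_contMDiffAt_nhds hn).1 h.embedding,
    h.embedding.continuousAt.eventually h1, h.left_inv.eventually_nhds] with y h2 h3 h4
  exact ⟨h2, h3, h4⟩

theorem contDiffAt_comp (h : IsRetractionAt F n ι r x) {f : M → V}
    (hf : ContMDiffAt 𝓘(ℝ, F) 𝓘(ℝ, V) n f x) : ContDiffAt ℝ n (f ∘ r) (ι x) :=
  (ContMDiffAt.comp_of_eq hf h.smooth h.apply_self).contDiffAt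

theorem mdifferentiableAt (h : IsRetractionAt F 1 ι r x) :
    MDifferentiableAt 𝓘(ℝ, E) 𝓘(ℝ, F) r (ι x) := h.smooth.mdifferentiableAt one_ne_zero

theorem mdifferentiableAt_embedding (h : IsRetractionAt F 1 ι r x) :
    MDifferentiableAt 𝓘(ℝ, F) 𝓘(ℝ, E) ι x := h.embedding.mdifferentiableAt one_ne_zero

/-- The directional derivative of a function on `M` as that of its local extension to `E`. -/
theorem mvfderiv_eq (h : IsRetractionAt F 1 ι r x) {f : M → V}
    (hf : MDifferentiableAt 𝓘(ℝ, F) 𝓘(ℝ, V) f x) (ξ : TangentSpace 𝓘(ℝ, F) x) :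
    mvfderiv 𝓘(ℝ, F) f x ξ = fderiv ℝ (f ∘ r) (ι x) (tangentIncl F ι x ξ) := by
  have h1 : DifferentiableAt ℝ (f ∘ r) (ι x) :=
    (MDifferentiableAt.comp_of_eq (ι x) hf h.mdifferentiableAt h.apply_self).differentiableAt
  have h2 : f =ᶠ[𝓝 x] fun y ↦ (f ∘ r) (ι y) := by
    filter_upwards [h.left_inv] with y hy
    simp [hy]
  rw [mvfderiv_congr h2, mvfderiv_comp_vec h1 h.mdifferentiableAt_embedding]
  rfl

theorem retractionDeriv_tangentIncl (h : IsRetractionAt F 1 ι r x)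
    (ξ : TangentSpace 𝓘(ℝ, F) x) : retractionDeriv F ι r x (tangentIncl F ι x ξ) = ξ := by
  have h1 := mfderiv_comp_apply x h.mdifferentiableAt h.mdifferentiableAt_embedding ξ
  have h2 : r ∘ ι =ᶠ[𝓝 x] id := h.left_inv
  rw [h2.mfderiv_eq, mfderiv_id] at h1
  exact h1.symm

theorem fderiv_comp_apply (h : IsRetractionAt F 1 ι r x) {f : M → V}
    (hf : MDifferentiableAt 𝓘(ℝ, F) 𝓘(ℝ, V) f x) (w : E) :
    fderiv ℝ (f ∘ r) (ι x) w = mvfderiv 𝓘(ℝ, F) f x (retractionDeriv F ι r x w) := by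
  have h1 := mfderiv_comp_apply_of_eq (ι x) hf h.mdifferentiableAt h.apply_self w
  rw [mfderiv_eq_fderiv] at h1
  exact h1

/-- Together with `fderiv_of_mem_range`: `d(ι ∘ r)` at `ι x` is a projection to the tangent space,
in general not the `g`-orthogonal one. -/
theorem fderiv_mem_range (h : IsRetractionAt F 1 ι r x) (w : E) :
    fderiv ℝ (ι ∘ r) (ι x) w ∈ (tangentIncl F ι x).range := by
  rw [h.fderiv_comp_apply h.mdifferentiableAt_embedding]
  exact ⟨retractionDeriv F ι r x w, rfl⟩

theorem fderiv_of_mem_range (h : IsRetractionAt F 1 ι r x) {w : E}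
    (hw : w ∈ (tangentIncl F ι x).range) : fderiv ℝ (ι ∘ r) (ι x) w = w := by
  obtain ⟨ξ, rfl⟩ := hw
  exact (h.mvfderiv_eq h.mdifferentiableAt_embedding ξ).symm

/-- Replaces the differential of `f`, whose domain varies with the point, by a map into the fixed
space `E →L[ℝ] V`, where smoothness can be stated directly. -/
theorem contMDiffAt_fderiv (h : IsRetractionAt F ∞ ι r x) {f : M → V}
    (hf : ContMDiffAt 𝓘(ℝ, F) 𝓘(ℝ, V) ∞ f x) :
    ContMDiffAt 𝓘(ℝ, F) 𝓘(ℝ, E →L[ℝ] V) ∞ (fun y ↦ fderiv ℝ (f ∘ r) (ι y)) x :=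
  ContMDiffAt.comp x ((h.contDiffAt_comp hf).fderiv_right (m := ∞) (by simp)).contMDiffAt
    h.embedding

end IsRetractionAt

variable {ι : M → E} {g : M → E →L[ℝ] E} {x : M}

theorem tangentIncl_injective (hι : Manifold.IsImmersion 𝓘(ℝ, F) 𝓘(ℝ, E) ∞ ι) (x : M) :
    Function.Injective (tangentIncl F ι x) := by
  obtain ⟨r, hr⟩ := exists_isRetractionAt hι x
  exact Function.LeftInverse.injective (hr.of_le (by simp)).retractionDeriv_tangentIncl

/-- The `E`-valued field is the vector part of the tangent map of `ι` composed with the section `Y`.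
-/
theorem contMDiffAt_fieldIncl [IsManifold 𝓘(ℝ, F) ∞ M] (hι : ContMDiff 𝓘(ℝ, F) 𝓘(ℝ, E) ∞ ι)
    {Y : Π x : M, TangentSpace 𝓘(ℝ, F) x} (hY : CMDiffAt ∞ (T% Y) x) :
    ContMDiffAt 𝓘(ℝ, F) 𝓘(ℝ, E) ∞ (fieldIncl F ι Y) x := by
  have h1 := hι.contMDiff_tangentMap (m := ∞) (by simp)
  exact ((contMDiff_snd_tangentBundle_modelSpace E 𝓘(ℝ, E)).comp h1).contMDiffAt.comp x hY

theorem mdifferentiableAt_fieldIncl [IsManifold 𝓘(ℝ, F) ∞ M]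
    (hι : ContMDiff 𝓘(ℝ, F) 𝓘(ℝ, E) ∞ ι)
    {Y : Π x : M, TangentSpace 𝓘(ℝ, F) x} (hY : MDiffAt (T% Y) x) :
    MDifferentiableAt 𝓘(ℝ, F) 𝓘(ℝ, E) (fieldIncl F ι Y) x := by
  have h1 := hι.contMDiff_tangentMap (m := ∞) (by simp)
  exact (((contMDiff_snd_tangentBundle_modelSpace E 𝓘(ℝ, E)).comp h1).contMDiffAt.mdifferentiableAt
    (by simp)).comp x hY

section FiniteDim

variable [FiniteDimensional ℝ E]

/-- Near a point, `metricProj_eq_of_projection` expresses `Π` through the smooth projections `P =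
d(ι ∘ r)`, the metric operator, and inversion, which is smooth at invertible operators. -/
theorem proj_contMDiff [IsManifold 𝓘(ℝ, F) ∞ M]
    (hι : Manifold.IsImmersion 𝓘(ℝ, F) 𝓘(ℝ, E) ∞ ι)
    (hg : ContMDiff 𝓘(ℝ, F) 𝓘(ℝ, E →L[ℝ] E) ∞ g) (hpos : ∀ x, IsPosDef (g x)) :
    ContMDiff 𝓘(ℝ, F) 𝓘(ℝ, E →L[ℝ] E) ∞ (proj F ι g) := by
  intro x
  have := FiniteDimensional.complete ℝ E
  obtain ⟨r, hr⟩ := exists_isRetractionAt hι x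
  set P : M → E →L[ℝ] E := fun y ↦ fderiv ℝ (ι ∘ r) (ι y)
  have hP : ContMDiffAt 𝓘(ℝ, F) 𝓘(ℝ, E →L[ℝ] E) ∞ P x :=
    hr.contMDiffAt_fderiv hι.contMDiff.contMDiffAt
  have hPt := contMDiffAt_const_clm_apply (adjointL E) hP
  have hQ : ContMDiffAt 𝓘(ℝ, F) 𝓘(ℝ, E →L[ℝ] E) ∞ (fun y ↦ .id ℝ E - P y) x :=
    contMDiffAt_const.sub hP
  have hB : ContMDiffAt 𝓘(ℝ, F) 𝓘(ℝ, E →L[ℝ] E) ∞ (fun y ↦ gramOp (P y) (g y)) x :=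
    (hPt.clm_comp ((hg x).clm_comp hP)).add
      ((contMDiffAt_const_clm_apply (adjointL E) hQ).clm_comp hQ)
  have hinv : ContMDiffAt 𝓘(ℝ, F) 𝓘(ℝ, E →L[ℝ] E) ∞ (fun y ↦ (gramOp (P y) (g y)).inverse) x :=
    ContMDiffAt.comp x
      ((gramOp_isInvertible (P x) (hpos x)).contDiffAt_map_inverse (n := ∞)).contMDiffAt hB
  refine (hP.clm_comp (hinv.clm_comp (hPt.clm_comp (hg x)))).congr_of_eventuallyEq ?_
  have hr1 : IsRetractionAt F 1 ι r x := hr.of_le (by simp)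
  have : IsManifold 𝓘(ℝ, F) 1 M := .of_le (n := ∞) (by simp)
  filter_upwards [hr1.eventually (by simp)] with y hy
  exact metricProj_eq_of_projection (hpos y) hy.fderiv_mem_range fun w hw ↦ hy.fderiv_of_mem_range hw

theorem proj_mem (ι : M → E) (g : M → E →L[ℝ] E) (x : M) (w : E) :
    ∃ ξ : TangentSpace 𝓘(ℝ, F) x, tangentIncl F ι x ξ = proj F ι g x w :=
  metricProj_mem (tangentIncl F ι x).range (g x) w

theorem proj_tangentIncl (hpos : ∀ x, IsPosDef (g x)) (x : M) (ξ : TangentSpace 𝓘(ℝ, F) x) :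
    proj F ι g x (tangentIncl F ι x ξ) = tangentIncl F ι x ξ :=
  metricProj_of_mem (hpos x) ⟨ξ, rfl⟩

theorem proj_idem (hpos : ∀ x, IsPosDef (g x)) (x : M) (w : E) :
    proj F ι g x (proj F ι g x w) = proj F ι g x w :=
  metricProj_idem (hpos x) w

theorem inner_proj_left (hpos : ∀ x, IsPosDef (g x)) (x : M) (v w : E) :
    inner ℝ (proj F ι g x v) (g x w) = inner ℝ v (g x (proj F ι g x w)) :=
  inner_metricProj_left (hpos x) v w

end FiniteDim

end

theorem two_le_infty : (2 : ℕ∞ω) ≤ ∞ :=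
  WithTop.coe_le_coe.2 (le_top : (2 : ℕ∞) ≤ ⊤)

/-! ### Vector fields as `E`-valued functions, and their brackets -/

section

variable {F : Type*} [NormedAddCommGroup F] [NormedSpace ℝ F]
  {M : Type*} [TopologicalSpace M] [ChartedSpace F M] [IsManifold 𝓘(ℝ, F) ∞ M]
  {E : Type*} [NormedAddCommGroup E] [InnerProductSpace ℝ E]
  {V : Type*} [NormedAddCommGroup V] [NormedSpace ℝ V]
  {ι : M → E} {x : M}

theorem IsRetractionAt.eventually_one {r : E → M} (h : IsRetractionAt F ∞ ι r x) :
    ∀ᶠ y in 𝓝 x, IsRetractionAt F 1 ι r y := by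
  have : IsManifold 𝓘(ℝ, F) 1 M := .of_le (n := ∞) (by simp)
  exact (h.of_le (by simp)).eventually (by simp)

/-- A tangent vector field is differentiable if it is so as an `E`-valued function. -/
theorem mdifferentiableAt_of_fieldIncl (hι : Manifold.IsImmersion 𝓘(ℝ, F) 𝓘(ℝ, E) ∞ ι)
    {Y : Π x : M, TangentSpace 𝓘(ℝ, F) x}
    (hY : MDifferentiableAt 𝓘(ℝ, F) 𝓘(ℝ, E) (fieldIncl F ι Y) x) : MDiffAt (T% Y) x := by
  have : IsManifold 𝓘(ℝ, F) 1 M := .of_le (n := ∞) (by simp)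
  rw [mdifferentiableAt_section]
  obtain ⟨r, hr⟩ := exists_isRetractionAt hι x
  -- In the trivialization at `x`, the field is the derivative of the chart along `Y`, which the
  -- retraction writes as a smooth operator applied to `fieldIncl F ι Y`.
  have h1 : ContMDiffAt 𝓘(ℝ, F) 𝓘(ℝ, F) ∞ (extChartAt 𝓘(ℝ, F) x) x := contMDiffAt_extChartAt
  have h2 := mdifferentiableAt_clm_apply
    ((hr.contMDiffAt_fderiv h1).mdifferentiableAt (by simp)) hY
  refine h2.congr_of_eventuallyEq ?_
  filter_upwards [hr.eventually_one, (chartAt F x).open_source.mem_nhds (mem_chart_source F x)]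
    with y hy hyx
  have h3 : MDifferentiableAt 𝓘(ℝ, F) 𝓘(ℝ, F) (extChartAt 𝓘(ℝ, F) x) y :=
    (contMDiffAt_extChartAt' (n := 1) hyx).mdifferentiableAt one_ne_zero
  have h4 := hy.mvfderiv_eq h3 (Y y)
  have h5 := TangentBundle.continuousLinearMapAt_trivializationAt (I := 𝓘(ℝ, F)) hyx
  refine Eq.trans ?_ h4
  have h6 := congrArg (fun L : TangentSpace 𝓘(ℝ, F) y →L[ℝ] F ↦ L (Y y)) h5
  refine Eq.trans ?_ h6
  rw [Bundle.Trivialization.continuousLinearMapAt_apply,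
    Bundle.Trivialization.coe_linearMapAt_of_mem]
  simpa using hyx

section Chart

variable (x) in
theorem mvfderiv_eq_chart {f : M → V} (hf : MDifferentiableAt 𝓘(ℝ, F) 𝓘(ℝ, V) f x)
    (ξ : TangentSpace 𝓘(ℝ, F) x) :
    mvfderiv 𝓘(ℝ, F) f x ξ = fderiv ℝ (f ∘ (extChartAt 𝓘(ℝ, F) x).symm) (extChartAt 𝓘(ℝ, F) x x)
      (mfderiv 𝓘(ℝ, F) 𝓘(ℝ, F) (extChartAt 𝓘(ℝ, F) x) x ξ) := by
  have : IsManifold 𝓘(ℝ, F) 1 M := .of_le (n := ∞) (by simp)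
  have h1 : f =ᶠ[𝓝 x] fun y ↦ (f ∘ (extChartAt 𝓘(ℝ, F) x).symm) (extChartAt 𝓘(ℝ, F) x y) := by
    filter_upwards [extChartAt_source_mem_nhds (I := 𝓘(ℝ, F)) x] with y hy
    rw [Function.comp_apply, (extChartAt 𝓘(ℝ, F) x).left_inv hy]
  have h2 : MDifferentiableAt 𝓘(ℝ, F) 𝓘(ℝ, F) (extChartAt 𝓘(ℝ, F) x).symm
      (extChartAt 𝓘(ℝ, F) x x) :=
    (mdifferentiableOn_extChartAt_symm.mdifferentiableAt (extChartAt_target_mem_nhds x))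
  have h3 : DifferentiableAt ℝ (f ∘ (extChartAt 𝓘(ℝ, F) x).symm) (extChartAt 𝓘(ℝ, F) x x) :=
    (MDifferentiableAt.comp_of_eq _ hf h2 (extChartAt_to_inv x)).differentiableAt
  rw [mvfderiv_congr h1, mvfderiv_comp_vec h3 (mdifferentiableAt_extChartAt (mem_chart_source F x))]
  rfl

theorem fderiv_comp_extChartAt_symm (hι : ContMDiff 𝓘(ℝ, F) 𝓘(ℝ, E) ∞ ι) {u : F}
    (hu : u ∈ (extChartAt 𝓘(ℝ, F) x).target) (v : F) :
    fderiv ℝ (ι ∘ (extChartAt 𝓘(ℝ, F) x).symm) u v =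
      tangentIncl F ι ((extChartAt 𝓘(ℝ, F) x).symm u)
        (mfderiv 𝓘(ℝ, F) 𝓘(ℝ, F) (extChartAt 𝓘(ℝ, F) x).symm u v) := by
  have : IsManifold 𝓘(ℝ, F) 1 M := .of_le (n := ∞) (by simp)
  have h2 : MDifferentiableAt 𝓘(ℝ, F) 𝓘(ℝ, F) (extChartAt 𝓘(ℝ, F) x).symm u :=
    (mdifferentiableOn_extChartAt_symm.mdifferentiableAt
      ((isOpen_extChartAt_target x).mem_nhds hu))
  have h1 := mfderiv_comp_apply u (hι.mdifferentiableAt (by simp)) h2 v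
  rw [mfderiv_eq_fderiv] at h1
  exact h1

theorem isInvertible_mfderiv_extChartAt_symm {u : F} (hu : u ∈ (extChartAt 𝓘(ℝ, F) x).target) :
    (mfderiv 𝓘(ℝ, F) 𝓘(ℝ, F) (extChartAt 𝓘(ℝ, F) x).symm u).IsInvertible := by
  have : IsManifold 𝓘(ℝ, F) 1 M := .of_le (n := ∞) (by simp)
  have h := isInvertible_mfderivWithin_extChartAt_symm (I := 𝓘(ℝ, F)) hu
  simpa [mfderivWithin_univ] using h

variable (x) in
/-- A vector field read in the preferred chart at `x`. -/
noncomputable def chartField (Y : Π x : M, TangentSpace 𝓘(ℝ, F) x) (u : F) : F :=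
  VectorField.mpullbackWithin 𝓘(ℝ, F) 𝓘(ℝ, F) (extChartAt 𝓘(ℝ, F) x).symm Y
    (Set.range 𝓘(ℝ, F)) u

/-- Writes the `E`-valued field, in the chart, as the derivative of the parametrization applied to
the coordinate field, so that the Leibniz rule applies. -/
theorem fderiv_chartField (hι : ContMDiff 𝓘(ℝ, F) 𝓘(ℝ, E) ∞ ι) {u : F}
    (hu : u ∈ (extChartAt 𝓘(ℝ, F) x).target) (Y : Π x : M, TangentSpace 𝓘(ℝ, F) x) :
    fderiv ℝ (ι ∘ (extChartAt 𝓘(ℝ, F) x).symm) u (chartField x Y u) =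
      fieldIncl F ι Y ((extChartAt 𝓘(ℝ, F) x).symm u) := by
  refine (fderiv_comp_extChartAt_symm hι hu _).trans ?_
  have h := isInvertible_mfderiv_extChartAt_symm hu
  have h1 := h.self_apply_inverse (Y ((extChartAt 𝓘(ℝ, F) x).symm u))
  rw [← mfderivWithin_univ] at h1
  have h2 : Set.range 𝓘(ℝ, F) = Set.univ := Set.range_id
  unfold chartField VectorField.mpullbackWithin fieldIncl
  rw [h2, ← mfderivWithin_univ]
  exact congrArg _ h1

theorem differentiableAt_chartField [CompleteSpace F] {Y : Π x : M, TangentSpace 𝓘(ℝ, F) x}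
    (hY : MDiffAt (T% Y) x) :
    DifferentiableAt ℝ (chartField x Y) (extChartAt 𝓘(ℝ, F) x x) := by
  have : IsManifold 𝓘(ℝ, F) 2 M := .of_le (n := ∞) two_le_infty
  have h : DifferentiableWithinAt ℝ (chartField x Y)
      ((extChartAt 𝓘(ℝ, F) x).symm ⁻¹' Set.univ ∩ Set.range 𝓘(ℝ, F)) (extChartAt 𝓘(ℝ, F) x x) :=
    MDifferentiableWithinAt.differentiableWithinAt_mpullbackWithin_vectorField
      hY.mdifferentiableWithinAt (s := Set.univ)
  have h2 : (extChartAt 𝓘(ℝ, F) x).symm ⁻¹' Set.univ ∩ Set.range 𝓘(ℝ, F) = Set.univ := by simp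
  rwa [h2, differentiableWithinAt_univ] at h

/-- The bracket on `M` is by definition the pullback of the bracket of the coordinate fields; the
differential of the chart undoes the pullback. -/
theorem mfderiv_mlieBracket (X Y : Π x : M, TangentSpace 𝓘(ℝ, F) x) :
    (mfderiv 𝓘(ℝ, F) 𝓘(ℝ, F) (extChartAt 𝓘(ℝ, F) x) x (VectorField.mlieBracket 𝓘(ℝ, F) X Y x) : F) =
      fderiv ℝ (chartField x Y) (extChartAt 𝓘(ℝ, F) x x)
          (chartField x X (extChartAt 𝓘(ℝ, F) x x)) -
        fderiv ℝ (chartField x X) (extChartAt 𝓘(ℝ, F) x x)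
          (chartField x Y (extChartAt 𝓘(ℝ, F) x x)) := by
  have : IsManifold 𝓘(ℝ, F) 1 M := .of_le (n := ∞) (by simp)
  have h2 : (extChartAt 𝓘(ℝ, F) x).symm ⁻¹' Set.univ ∩ Set.range 𝓘(ℝ, F) = Set.univ := by simp
  have h : (mfderiv 𝓘(ℝ, F) 𝓘(ℝ, F) (extChartAt 𝓘(ℝ, F) x) x).IsInvertible :=
    isInvertible_mfderiv_extChartAt (mem_extChartAt_source x)
  have h3 := h.self_apply_inverse (VectorField.lieBracketWithin ℝ (E := F) (chartField x X)
    (chartField x Y) ((extChartAt 𝓘(ℝ, F) x).symm ⁻¹' Set.univ ∩ Set.range 𝓘(ℝ, F))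
    (extChartAt 𝓘(ℝ, F) x x) : F)
  refine Eq.trans h3 ?_
  rw [h2, VectorField.lieBracketWithin_univ]
  rfl

/-- The bracket of two tangent vector fields, from their derivatives as `E`-valued functions. -/
theorem tangentIncl_mlieBracket [CompleteSpace F] (hι : Manifold.IsImmersion 𝓘(ℝ, F) 𝓘(ℝ, E) ∞ ι)
    {X Y : Π x : M, TangentSpace 𝓘(ℝ, F) x} (hX : MDiffAt (T% X) x) (hY : MDiffAt (T% Y) x) :
    tangentIncl F ι x (VectorField.mlieBracket 𝓘(ℝ, F) X Y x) =
      mvfderiv 𝓘(ℝ, F) (fieldIncl F ι Y) x (X x) - mvfderiv 𝓘(ℝ, F) (fieldIncl F ι X) x (Y x) := by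
  set φ := extChartAt 𝓘(ℝ, F) x
  set h : F → E := ι ∘ φ.symm
  have hιs := hι.contMDiff
  have hιx : MDifferentiableAt 𝓘(ℝ, F) 𝓘(ℝ, E) ι x := hιs.mdifferentiableAt (by simp)
  have htarget : φ.target ∈ 𝓝 (φ x) := extChartAt_target_mem_nhds x
  have hsmooth : ContDiffAt ℝ ∞ h (φ x) := by
    have h1 : ContMDiffAt 𝓘(ℝ, F) 𝓘(ℝ, F) ∞ φ.symm (φ x) :=
      (contMDiffOn_extChartAt_symm x).contMDiffAt htarget
    exact (hιs.contMDiffAt.comp _ h1).contDiffAt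
  have hd : DifferentiableAt ℝ (fderiv ℝ h) (φ x) :=
    (hsmooth.fderiv_right (m := 1) (by norm_cast)).differentiableAt (by simp)
  have hsym : IsSymmSndFDerivAt ℝ h (φ x) :=
    hsmooth.isSymmSndFDerivAt (by simpa using two_le_infty)
  have hincl : ∀ ξ : TangentSpace 𝓘(ℝ, F) x, tangentIncl F ι x ξ =
      fderiv ℝ h (φ x) (mfderiv 𝓘(ℝ, F) 𝓘(ℝ, F) φ x ξ) := fun ξ ↦ mvfderiv_eq_chart x hιx ξ
  have hφx : φ.symm (φ x) = x := extChartAt_to_inv x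
  have hinj : Function.Injective (fderiv ℝ h (φ x)) := by
    intro v w hvw
    rw [fderiv_comp_extChartAt_symm hιs (mem_extChartAt_target x),
      fderiv_comp_extChartAt_symm hιs (mem_extChartAt_target x)] at hvw
    obtain ⟨e, he⟩ := isInvertible_mfderiv_extChartAt_symm (mem_extChartAt_target (I := 𝓘(ℝ, F)) x)
    have h1 := tangentIncl_injective hι _ hvw
    rw [← he] at h1
    exact e.injective h1
  -- The two coordinate vectors have the same image under the injective differential of `h`.
  have hvec : ∀ X : Π x : M, TangentSpace 𝓘(ℝ, F) x,
      (mfderiv 𝓘(ℝ, F) 𝓘(ℝ, F) φ x (X x) : F) = chartField x X (φ x) := by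
    intro X
    refine hinj ((hincl (X x)).symm.trans ?_)
    rw [fderiv_chartField hιs (mem_extChartAt_target x), hφx]
    rfl
  have hder : ∀ {X Y : Π x : M, TangentSpace 𝓘(ℝ, F) x}, MDiffAt (T% Y) x →
      mvfderiv 𝓘(ℝ, F) (fieldIncl F ι Y) x (X x) =
        fderiv ℝ (fderiv ℝ h) (φ x) (chartField x X (φ x)) (chartField x Y (φ x)) +
          fderiv ℝ h (φ x) (fderiv ℝ (chartField x Y) (φ x) (chartField x X (φ x))) := by
    intro X Y hY
    have h1 : fieldIncl F ι Y ∘ φ.symm =ᶠ[𝓝 (φ x)] fun u ↦ fderiv ℝ h u (chartField x Y u) := by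
      filter_upwards [htarget] with u hu
      exact (fderiv_chartField hιs hu Y).symm
    refine (mvfderiv_eq_chart x (mdifferentiableAt_fieldIncl hιs hY) (X x)).trans ?_
    rw [h1.fderiv_eq, fderiv_clm_apply hd (differentiableAt_chartField hY)]
    refine (congrArg _ (hvec X)).trans ?_
    simp [add_comm, φ]
  refine (hincl _).trans ?_
  rw [hder hY, hder hX]
  refine (congrArg _ (mfderiv_mlieBracket X Y)).trans ?_
  -- The second-derivative terms of `h` cancel by symmetry.
  rw [map_sub, hsym.eq (chartField x X (φ x)) (chartField x Y (φ x))]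
  abel

end Chart

/-- On smooth functions, the bracket of vector fields is the commutator of their directional
derivatives. -/
theorem mvfderiv_mlieBracket [CompleteSpace F] (hι : Manifold.IsImmersion 𝓘(ℝ, F) 𝓘(ℝ, E) ∞ ι)
    {X Y : Π x : M, TangentSpace 𝓘(ℝ, F) x} (hX : MDiffAt (T% X) x) (hY : MDiffAt (T% Y) x)
    {f : M → V} (hf : ContMDiffAt 𝓘(ℝ, F) 𝓘(ℝ, V) ∞ f x) :
    mvfderiv 𝓘(ℝ, F) f x (VectorField.mlieBracket 𝓘(ℝ, F) X Y x) =
      mvfderiv 𝓘(ℝ, F) (fun y ↦ mvfderiv 𝓘(ℝ, F) f y (Y y)) x (X x) -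
        mvfderiv 𝓘(ℝ, F) (fun y ↦ mvfderiv 𝓘(ℝ, F) f y (X y)) x (Y x) := by
  have : IsManifold 𝓘(ℝ, F) 1 M := .of_le (n := ∞) (by simp)
  obtain ⟨r, hr⟩ := exists_isRetractionAt hι x
  have hr1 : IsRetractionAt F 1 ι r x := hr.of_le (by simp)
  have hιs := hι.contMDiff
  have hf1 : ∀ᶠ y in 𝓝 x, ContMDiffAt 𝓘(ℝ, F) 𝓘(ℝ, V) 1 f y :=
    (contMDiffAt_iff_contMDiffAt_nhds (by simp)).1 (hf.of_le (by simp))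
  have hsmooth := hr.contDiffAt_comp hf
  have hd : DifferentiableAt ℝ (fderiv ℝ (f ∘ r)) (ι x) :=
    (hsmooth.fderiv_right (m := 1) (by norm_cast)).differentiableAt (by simp)
  have hsym : IsSymmSndFDerivAt ℝ (f ∘ r) (ι x) :=
    hsmooth.isSymmSndFDerivAt (by simpa using two_le_infty)
  -- The Leibniz rule for the extension `f ∘ r`: a Hessian term, symmetric in the two fields, and a
  -- first-order term whose antisymmetrization is the bracket.
  have hder : ∀ {X Y : Π x : M, TangentSpace 𝓘(ℝ, F) x}, MDiffAt (T% Y) x →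
      mvfderiv 𝓘(ℝ, F) (fun y ↦ mvfderiv 𝓘(ℝ, F) f y (Y y)) x (X x) =
        fderiv ℝ (fderiv ℝ (f ∘ r)) (ι x) (tangentIncl F ι x (X x)) (tangentIncl F ι x (Y x)) +
          fderiv ℝ (f ∘ r) (ι x) (mvfderiv 𝓘(ℝ, F) (fieldIncl F ι Y) x (X x)) := by
    intro X Y hY
    have h1 : (fun y ↦ mvfderiv 𝓘(ℝ, F) f y (Y y)) =ᶠ[𝓝 x]
        fun y ↦ fderiv ℝ (f ∘ r) (ι y) (fieldIncl F ι Y y) := by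
      filter_upwards [hf1, hr.eventually_one] with y h2 h3
      exact h3.mvfderiv_eq (h2.mdifferentiableAt one_ne_zero) (Y y)
    rw [mvfderiv_congr h1, mvfderiv_clm_apply
      ((hr.contMDiffAt_fderiv hf).mdifferentiableAt (by simp)) (mdifferentiableAt_fieldIncl hιs hY),
      mvfderiv_comp_vec hd (hιs.mdifferentiableAt (by simp))]
    rfl
  rw [hr1.mvfderiv_eq (hf.mdifferentiableAt (by simp)), tangentIncl_mlieBracket hι hX hY, map_sub,
    hder hY, hder hX, hsym.eq (tangentIncl F ι x (X x))]
  abel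

end

/-! ### The ambient connection, the derivative of `Π`, and the second fundamental form -/

section

variable {F : Type*} [NormedAddCommGroup F] [NormedSpace ℝ F]
  {M : Type*} [TopologicalSpace M] [ChartedSpace F M]
  {E : Type*} [NormedAddCommGroup E] [InnerProductSpace ℝ E]

variable (F) in
/-- An immersion `ι`, a metric operator `g`, and a function `Γ^E` that is symmetric on tangent
vectors and compatible with `g`. -/
structure IsMetricChristoffel (ι : M → E) (g : M → E →L[ℝ] E) (ΓE : M → E →L[ℝ] E →L[ℝ] E) :
    Prop where
  immersion : Manifold.IsImmersion 𝓘(ℝ, F) 𝓘(ℝ, E) ∞ ι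
  smooth_metric : ContMDiff 𝓘(ℝ, F) 𝓘(ℝ, E →L[ℝ] E) ∞ g
  posDef : ∀ x, IsPosDef (g x)
  smooth : ContMDiff 𝓘(ℝ, F) 𝓘(ℝ, E →L[ℝ] E →L[ℝ] E) ∞ ΓE
  symm : ∀ (x : M) (ξ η : TangentSpace 𝓘(ℝ, F) x),
    ΓE x (tangentIncl F ι x ξ) (tangentIncl F ι x η) =
      ΓE x (tangentIncl F ι x η) (tangentIncl F ι x ξ)
  metric : ∀ (x : M) (ξ η : TangentSpace 𝓘(ℝ, F) x) (w : E),
    inner ℝ (tangentIncl F ι x η) (mvfderiv 𝓘(ℝ, F) g x ξ w) =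
      inner ℝ (ΓE x (tangentIncl F ι x ξ) (tangentIncl F ι x η)) (g x w) +
        inner ℝ (tangentIncl F ι x η) (g x (ΓE x (tangentIncl F ι x ξ) w))

namespace IsMetricChristoffel

variable {ι : M → E} {g : M → E →L[ℝ] E} {ΓE : M → E →L[ℝ] E →L[ℝ] E} {x : M}

theorem mdifferentiableAt_embedding (h : IsMetricChristoffel F ι g ΓE) (x : M) :
    MDifferentiableAt 𝓘(ℝ, F) 𝓘(ℝ, E) ι x :=
  h.immersion.contMDiff.mdifferentiableAt (by simp)

theorem mdifferentiableAt_metric (h : IsMetricChristoffel F ι g ΓE) (x : M) :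
    MDifferentiableAt 𝓘(ℝ, F) 𝓘(ℝ, E →L[ℝ] E) g x := h.smooth_metric.mdifferentiableAt (by simp)

theorem mdifferentiableAt (h : IsMetricChristoffel F ι g ΓE) (x : M) :
    MDifferentiableAt 𝓘(ℝ, F) 𝓘(ℝ, E →L[ℝ] E →L[ℝ] E) ΓE x := h.smooth.mdifferentiableAt (by simp)

variable [IsManifold 𝓘(ℝ, F) ∞ M]

theorem mdifferentiableAt_fieldIncl (h : IsMetricChristoffel F ι g ΓE)
    {Y : Π x : M, TangentSpace 𝓘(ℝ, F) x} (hY : MDiffAt (T% Y) x) :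
    MDifferentiableAt 𝓘(ℝ, F) 𝓘(ℝ, E) (fieldIncl F ι Y) x :=
  EmbeddedAmbient.mdifferentiableAt_fieldIncl h.immersion.contMDiff hY

/-- The `Γ^E` terms cancel by symmetry, leaving the commutator of directional derivatives in `E`. -/
theorem ambientConnection_torsion [CompleteSpace F] (h : IsMetricChristoffel F ι g ΓE)
    {X Y : Π x : M, TangentSpace 𝓘(ℝ, F) x} (hX : MDiffAt (T% X) x) (hY : MDiffAt (T% Y) x) :
    ambientConnection F ι ΓE (fieldIncl F ι Y) x (X x) -
      ambientConnection F ι ΓE (fieldIncl F ι X) x (Y x) =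
        tangentIncl F ι x (VectorField.mlieBracket 𝓘(ℝ, F) X Y x) := by
  rw [ambientConnection_apply, ambientConnection_apply, tangentIncl_mlieBracket h.immersion hX hY]
  simp only [fieldIncl]
  rw [h.symm x (X x) (Y x)]
  exact add_sub_add_right_eq_sub _ _ _

/-- The Leibniz rule leaves one term with `D_ξ g`, and the hypothesis on `Γ^E` replaces it by the
two Christoffel terms. -/
theorem ambientConnection_metric (h : IsMetricChristoffel F ι g ΓE)
    {Y : Π x : M, TangentSpace 𝓘(ℝ, F) x} {s : M → E} (hY : MDiffAt (T% Y) x)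
    (hs : MDifferentiableAt 𝓘(ℝ, F) 𝓘(ℝ, E) s x) (ξ : TangentSpace 𝓘(ℝ, F) x) :
    mvfderiv 𝓘(ℝ, F) (fun y ↦ (inner ℝ (fieldIncl F ι Y y) (g y (s y)) : ℝ)) x ξ =
      inner ℝ (ambientConnection F ι ΓE (fieldIncl F ι Y) x ξ : E) (g x (s x)) +
        inner ℝ (fieldIncl F ι Y x) (g x (ambientConnection F ι ΓE s x ξ)) := by
  rw [mvfderiv_inner (h.mdifferentiableAt_fieldIncl hY)
    (mdifferentiableAt_clm_apply (h.mdifferentiableAt_metric x) hs),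
    mvfderiv_clm_apply (h.mdifferentiableAt_metric x) hs, ambientConnection_apply,
    ambientConnection_apply, map_add, inner_add_left, inner_add_right, inner_add_right]
  simp only [fieldIncl]
  rw [h.metric x ξ (Y x) (s x)]
  ring

variable [FiniteDimensional ℝ E]

theorem mdifferentiableAt_proj (h : IsMetricChristoffel F ι g ΓE) (x : M) :
    MDifferentiableAt 𝓘(ℝ, F) 𝓘(ℝ, E →L[ℝ] E) (proj F ι g) x :=
  (proj_contMDiff h.immersion h.smooth_metric h.posDef).mdifferentiableAt (by simp)

/-- The derivative of `Π² = Π`. -/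
theorem mvfderiv_proj_add (h : IsMetricChristoffel F ι g ΓE) (x : M) (ξ : TangentSpace 𝓘(ℝ, F) x)
    (w : E) :
    mvfderiv 𝓘(ℝ, F) (proj F ι g) x ξ (proj F ι g x w) +
      proj F ι g x (mvfderiv 𝓘(ℝ, F) (proj F ι g) x ξ w) =
        mvfderiv 𝓘(ℝ, F) (proj F ι g) x ξ w := by
  have hP := h.mdifferentiableAt_proj x
  have hc : MDifferentiableAt 𝓘(ℝ, F) 𝓘(ℝ, E) (fun _ : M ↦ w) x := mdifferentiableAt_const
  have hPw := mdifferentiableAt_clm_apply hP hc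
  have h1 := mvfderiv_clm_apply hP hPw ξ
  simp only [proj_idem h.posDef] at h1
  rw [mvfderiv_clm_apply hP hc, mvfderiv_const] at h1
  simpa using h1.symm

/-- From the derivative of `Π² = Π`: `D_ξ Π` sends tangent vectors to normal ones and, by the next
lemma, normal vectors to tangent ones. -/
theorem proj_mvfderiv_proj_tangentIncl (h : IsMetricChristoffel F ι g ΓE) (x : M)
    (ξ η : TangentSpace 𝓘(ℝ, F) x) :
    proj F ι g x (mvfderiv 𝓘(ℝ, F) (proj F ι g) x ξ (tangentIncl F ι x η)) = 0 := by
  have h1 := h.mvfderiv_proj_add x ξ (tangentIncl F ι x η)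
  rw [proj_tangentIncl h.posDef] at h1
  simpa using h1

theorem proj_mvfderiv_proj_of_proj_eq_zero (h : IsMetricChristoffel F ι g ΓE) (x : M)
    (ξ : TangentSpace 𝓘(ℝ, F) x) {w : E} (hw : proj F ι g x w = 0) :
    proj F ι g x (mvfderiv 𝓘(ℝ, F) (proj F ι g) x ξ w) =
      mvfderiv 𝓘(ℝ, F) (proj F ι g) x ξ w := by
  have h1 := h.mvfderiv_proj_add x ξ w
  rwa [hw, map_zero, zero_add] at h1

/-- The derivative of the identity `⟪Π v, g w⟫ = ⟪v, g Π w⟫`. -/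
theorem inner_mvfderiv_proj (h : IsMetricChristoffel F ι g ΓE) (x : M)
    (ξ : TangentSpace 𝓘(ℝ, F) x) (v w : E) :
    inner ℝ (mvfderiv 𝓘(ℝ, F) (proj F ι g) x ξ v) (g x w) +
        inner ℝ (proj F ι g x v) (mvfderiv 𝓘(ℝ, F) g x ξ w) =
      inner ℝ v (mvfderiv 𝓘(ℝ, F) g x ξ (proj F ι g x w)) +
        inner ℝ v (g x (mvfderiv 𝓘(ℝ, F) (proj F ι g) x ξ w)) := by
  have hP := h.mdifferentiableAt_proj x
  have hg := h.mdifferentiableAt_metric x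
  have hc : ∀ u : E, MDifferentiableAt 𝓘(ℝ, F) 𝓘(ℝ, E) (fun _ : M ↦ u) x :=
    fun u ↦ mdifferentiableAt_const
  have hPw := mdifferentiableAt_clm_apply hP (hc w)
  have h1 := mvfderiv_inner (mdifferentiableAt_clm_apply hP (hc v))
    (mdifferentiableAt_clm_apply hg (hc w)) ξ
  have h2 := mvfderiv_inner (hc v) (mdifferentiableAt_clm_apply hg hPw) ξ
  simp only [inner_proj_left h.posDef] at h1
  rw [h2, mvfderiv_clm_apply hP (hc v), mvfderiv_clm_apply hg (hc w), mvfderiv_clm_apply hg hPw,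
    mvfderiv_clm_apply hP (hc w), mvfderiv_const, mvfderiv_const] at h1
  simp only [zero_apply, map_zero, add_zero, inner_zero_left, zero_add,
    inner_add_right] at h1
  exact h1.symm

omit [IsManifold 𝓘(ℝ, F) ∞ M] in
theorem secondForm_apply (x : M) (ξ η : TangentSpace 𝓘(ℝ, F) x) :
    secondForm F ι g ΓE x ξ η =
      mvfderiv 𝓘(ℝ, F) (proj F ι g) x ξ (tangentIncl F ι x η) +
        (ContinuousLinearMap.id ℝ E - proj F ι g x)
          (ΓE x (tangentIncl F ι x ξ) (tangentIncl F ι x η)) := by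
  simp [secondForm, tangentChristoffel]
  abel

theorem proj_secondForm (h : IsMetricChristoffel F ι g ΓE) (x : M)
    (ξ η : TangentSpace 𝓘(ℝ, F) x) : proj F ι g x (secondForm F ι g ΓE x ξ η) = 0 := by
  rw [secondForm_apply, map_add, h.proj_mvfderiv_proj_tangentIncl]
  simp [proj_idem h.posDef]

/-- The derivative of `Π Y = Y`. -/
theorem mvfderiv_fieldIncl (h : IsMetricChristoffel F ι g ΓE)
    {Y : Π x : M, TangentSpace 𝓘(ℝ, F) x} (hY : MDiffAt (T% Y) x) (ξ : TangentSpace 𝓘(ℝ, F) x) :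
    mvfderiv 𝓘(ℝ, F) (fieldIncl F ι Y) x ξ =
      mvfderiv 𝓘(ℝ, F) (proj F ι g) x ξ (fieldIncl F ι Y x) +
        proj F ι g x (mvfderiv 𝓘(ℝ, F) (fieldIncl F ι Y) x ξ) := by
  have h1 := mvfderiv_clm_apply (h.mdifferentiableAt_proj x) (h.mdifferentiableAt_fieldIncl hY) ξ
  have h2 : (fun y ↦ proj F ι g y (fieldIncl F ι Y y)) = fieldIncl F ι Y :=
    funext fun y ↦ proj_tangentIncl h.posDef y (Y y)
  rwa [h2] at h1

/-- The Gauss formula: the normal component of `∇^E_ξ Y` is `II(ξ, Y)`. -/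
theorem ambientConnection_sub_proj (h : IsMetricChristoffel F ι g ΓE)
    {Y : Π x : M, TangentSpace 𝓘(ℝ, F) x} (hY : MDiffAt (T% Y) x) (ξ : TangentSpace 𝓘(ℝ, F) x) :
    ambientConnection F ι ΓE (fieldIncl F ι Y) x ξ -
      proj F ι g x (ambientConnection F ι ΓE (fieldIncl F ι Y) x ξ) =
        secondForm F ι g ΓE x ξ (Y x) := by
  rw [secondForm_apply, ambientConnection_apply, map_add]
  nth_rw 1 [h.mvfderiv_fieldIncl hY]
  simp only [fieldIncl, sub_apply, ContinuousLinearMap.id_apply]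
  abel

/-- For fields extending `ξ` and `η`, the difference of the two sides is the normal component of
`∇^E_X Y - ∇^E_Y X = [X, Y]`, which is tangent. -/
theorem secondForm_symm [FiniteDimensional ℝ F] (h : IsMetricChristoffel F ι g ΓE) (x : M)
    (ξ η : TangentSpace 𝓘(ℝ, F) x) :
    secondForm F ι g ΓE x ξ η = secondForm F ι g ΓE x η ξ := by
  have := FiniteDimensional.complete ℝ F
  have : IsManifold 𝓘(ℝ, F) 1 M := .of_le (n := ∞) (by simp)
  have : IsManifold 𝓘(ℝ, F) 2 M := .of_le (n := ∞) two_le_infty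
  have hX : MDiffAt (T% (FiberBundle.extend F ξ)) x := FiberBundle.mdifferentiableAt_extend ..
  have hY : MDiffAt (T% (FiberBundle.extend F η)) x := FiberBundle.mdifferentiableAt_extend ..
  have h1 := h.ambientConnection_sub_proj hX η
  have h2 := h.ambientConnection_sub_proj hY ξ
  have h3 := h.ambientConnection_torsion hX hY
  simp only [FiberBundle.extend_apply_self] at h1 h2 h3
  have h4 := proj_tangentIncl (ι := ι) h.posDef x
    (VectorField.mlieBracket 𝓘(ℝ, F) (FiberBundle.extend F ξ) (FiberBundle.extend F η) x)
  rw [← h3, map_sub] at h4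
  rw [← h1, ← h2, ← sub_eq_zero]
  rw [← sub_eq_zero] at h4
  rw [← neg_eq_zero, ← h4]
  abel

end IsMetricChristoffel

end

/-! ### The Levi-Civita connection and the adjoint of `II` -/

section

variable {F : Type*} [NormedAddCommGroup F] [NormedSpace ℝ F] [FiniteDimensional ℝ F]
  {M : Type*} [TopologicalSpace M] [ChartedSpace F M] [IsManifold 𝓘(ℝ, F) ∞ M]
  [RiemannianBundle (fun x : M ↦ TangentSpace 𝓘(ℝ, F) x)]

/-- The uniqueness of the Levi-Civita connection. -/
theorem IsLeviCivita.eq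
    {nabla nabla' : CovariantDerivative 𝓘(ℝ, F) F (fun x : M ↦ TangentSpace 𝓘(ℝ, F) x)}
    (h : IsLeviCivita F nabla) (h' : IsLeviCivita F nabla') {Y : Π x : M, TangentSpace 𝓘(ℝ, F) x}
    {x : M} (hY : MDiffAt (T% Y) x) : nabla Y x = nabla' Y x := by
  have := FiniteDimensional.complete ℝ F
  have : IsManifold 𝓘(ℝ, F) 1 M := .of_le (n := ∞) (by simp)
  have : IsManifold 𝓘(ℝ, F) 2 M := .of_le (n := ∞) two_le_infty
  -- The difference of the connections: `⟪A X Y, Z⟫` is symmetric in `X`, `Y` because both are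
  -- torsion-free, and skew in `Y`, `Z` because both are metric. Alternating the two symmetries
  -- gives its own negative.
  let A : (Π x : M, TangentSpace 𝓘(ℝ, F) x) → (Π x : M, TangentSpace 𝓘(ℝ, F) x) →
      TangentSpace 𝓘(ℝ, F) x := fun X Y ↦ nabla Y x (X x) - nabla' Y x (X x)
  have hsymm : ∀ {X Y : Π x : M, TangentSpace 𝓘(ℝ, F) x}, MDiffAt (T% X) x → MDiffAt (T% Y) x →
      A X Y = A Y X := by
    intro X Y hX hY
    have h1 := nabla.torsion_eq_zero_iff.1 h.torsion_eq_zero hX hY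
    have h2 := nabla'.torsion_eq_zero_iff.1 h'.torsion_eq_zero hX hY
    have h3 : nabla Y x (X x) - nabla X x (Y x) = nabla' Y x (X x) - nabla' X x (Y x) :=
      h1.trans h2.symm
    exact sub_eq_sub_iff_sub_eq_sub.1 h3
  have hskew : ∀ {X Y Z : Π x : M, TangentSpace 𝓘(ℝ, F) x}, MDiffAt (T% Y) x → MDiffAt (T% Z) x →
      (inner ℝ (A X Y) (Z x) : ℝ) = -inner ℝ (A X Z) (Y x) := by
    intro X Y Z hY hZ
    have h1 := h.metric X Y Z x hY hZ
    have h2 := h'.metric X Y Z x hY hZ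
    rw [h1] at h2
    simp only [A, inner_sub_left]
    rw [real_inner_comm (Y x), real_inner_comm (Y x)]
    linarith
  ext ξ
  have hX : MDiffAt (T% (FiberBundle.extend F ξ)) x := FiberBundle.mdifferentiableAt_extend ..
  have key : A (FiberBundle.extend F ξ) Y = 0 := by
    refine ext_inner_right ℝ fun ζ ↦ ?_
    have hZ : MDiffAt (T% (FiberBundle.extend F ζ)) x := FiberBundle.mdifferentiableAt_extend ..
    set X := FiberBundle.extend F ξ
    set Z := FiberBundle.extend F ζ with hZdef
    have hζ : ζ = Z x := by simp [hZdef]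
    rw [inner_zero_left, hζ]
    have e1 := hskew (X := X) hY hZ
    have e2 := hskew (X := Z) hX hY
    have e3 := hskew (X := Y) hZ hX
    rw [hsymm hX hZ] at e1
    rw [hsymm hZ hY] at e2
    rw [hsymm hY hX] at e3
    linarith
  have key2 := sub_eq_zero.1 key
  simpa using key2

variable {E : Type*} [NormedAddCommGroup E] [InnerProductSpace ℝ E] [FiniteDimensional ℝ E]
  {ι : M → E} {g : M → E →L[ℝ] E} {ΓE : M → E →L[ℝ] E →L[ℝ] E} {x : M}

namespace IsMetricChristoffel

omit [FiniteDimensional ℝ F] [RiemannianBundle (fun x : M ↦ TangentSpace 𝓘(ℝ, F) x)] in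
/-- The adjoint of `II_ξ`, on the level of `E`. -/
theorem inner_secondForm (h : IsMetricChristoffel F ι g ΓE) (ξ η : TangentSpace 𝓘(ℝ, F) x)
    (w : E) :
    inner ℝ (secondForm F ι g ΓE x ξ η) (g x w) =
      inner ℝ (tangentIncl F ι x η)
        (g x (-tangentChristoffel F ι g ΓE x ξ (w - proj F ι g x w))) := by
  set n := w - proj F ι g x w with hn
  have hPn : proj F ι g x n = 0 := by rw [hn, map_sub, proj_idem h.posDef, sub_self]
  -- As `II` is normal, only the normal part `n` of `w` contributes.
  have h1 : inner ℝ (secondForm F ι g ΓE x ξ η) (g x (proj F ι g x w)) = 0 := by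
    rw [← inner_proj_left h.posDef, h.proj_secondForm, inner_zero_left]
  have h2 : g x w = g x n + g x (proj F ι g x w) := by rw [← map_add, hn, sub_add_cancel]
  rw [h2, inner_add_right, h1, add_zero, secondForm_apply]
  -- The differentiated `g`-symmetry of `Π`, on a tangent and a normal vector, moves `D_ξ Π` across
  -- the inner product at the cost of a `D_ξ g` term, which `h.metric` turns into `Γ^E` terms.
  have h3 := h.inner_mvfderiv_proj x ξ (tangentIncl F ι x η) n
  rw [hPn, map_zero, inner_zero_right, zero_add, proj_tangentIncl h.posDef, h.metric x ξ η n] at h3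
  have h4 := inner_proj_left (F := F) (ι := ι) h.posDef x
    (ΓE x (tangentIncl F ι x ξ) (tangentIncl F ι x η)) n
  rw [hPn, map_zero, inner_zero_right] at h4
  have h5 := inner_proj_left (F := F) (ι := ι) h.posDef x (tangentIncl F ι x η)
    (ΓE x (tangentIncl F ι x ξ) n)
  rw [proj_tangentIncl h.posDef] at h5
  simp only [tangentChristoffel, add_apply, neg_apply, ContinuousLinearMap.comp_apply, sub_apply,
    ContinuousLinearMap.id_apply, neg_add, neg_neg, map_add, map_neg, inner_add_left,
    inner_add_right, inner_neg_right, inner_sub_left]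
  linarith

/-- `II_ξ† w = -Γ(ξ, (I - Π) w)`. -/
theorem tangentIncl_secondFormAdjoint (h : IsMetricChristoffel F ι g ΓE)
    (hg : IsAmbientStructure F ι g) (ξ : TangentSpace 𝓘(ℝ, F) x) (w : E) :
    tangentIncl F ι x (secondFormAdjoint F ι g ΓE x ξ w) =
      -tangentChristoffel F ι g ΓE x ξ (w - proj F ι g x w) := by
  set n := w - proj F ι g x w with hn
  have hPn : proj F ι g x n = 0 := by rw [hn, map_sub, proj_idem h.posDef, sub_self]
  -- `Γ(ξ, n)` is tangent because `D_ξ Π` sends the normal vector `n` to a tangent one; so it can be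
  -- compared with the adjoint inside `T_x M`.
  have h1 : proj F ι g x (-tangentChristoffel F ι g ΓE x ξ n) =
      -tangentChristoffel F ι g ΓE x ξ n := by
    simp [tangentChristoffel, proj_idem h.posDef, h.proj_mvfderiv_proj_of_proj_eq_zero x ξ hPn]
  obtain ⟨ζ, hζ⟩ := proj_mem (F := F) ι g x (-tangentChristoffel F ι g ΓE x ξ n)
  rw [h1] at hζ
  rw [← hζ]
  congr 1
  refine ext_inner_left ℝ fun η ↦ ?_
  rw [inner_secondFormAdjoint, h.inner_secondForm, hg.metric, hζ]

-- The differential of a retraction inverts `dι` on its range. The resulting `j` gives projected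
-- derivatives values in `T_x M`, and extends functions of a tangent vector to `E`.
omit [FiniteDimensional ℝ F] [IsManifold 𝓘(ℝ, F) ∞ M]
  [RiemannianBundle (fun x : M ↦ TangentSpace 𝓘(ℝ, F) x)] in
theorem exists_tangentIncl_eq_proj (h : IsMetricChristoffel F ι g ΓE) (x : M) :
    ∃ j : E →L[ℝ] TangentSpace 𝓘(ℝ, F) x, ∀ w, tangentIncl F ι x (j w) = proj F ι g x w := by
  obtain ⟨r, hr⟩ := exists_isRetractionAt h.immersion x
  refine ⟨retractionDeriv F ι r x ∘L proj F ι g x, fun w ↦ ?_⟩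
  obtain ⟨ζ, hζ⟩ := proj_mem (F := F) ι g x w
  rw [ContinuousLinearMap.comp_apply, ← hζ, (hr.of_le (by simp)).retractionDeriv_tangentIncl]

/-- The Levi-Civita connection `∇_ξ Y = Π ∇^E_ξ Y`, by its value in `E`. -/
theorem exists_isLeviCivita (h : IsMetricChristoffel F ι g ΓE) (hg : IsAmbientStructure F ι g) :
    ∃ nabla : CovariantDerivative 𝓘(ℝ, F) F (fun x : M ↦ TangentSpace 𝓘(ℝ, F) x),
      IsLeviCivita F nabla ∧
        ∀ (Y : Π x : M, TangentSpace 𝓘(ℝ, F) x) (x : M) (ξ : TangentSpace 𝓘(ℝ, F) x),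
          tangentIncl F ι x (nabla Y x ξ) =
            proj F ι g x (ambientConnection F ι ΓE (fieldIncl F ι Y) x ξ) := by
  have := FiniteDimensional.complete ℝ F
  have : IsManifold 𝓘(ℝ, F) 1 M := .of_le (n := ∞) (by simp)
  have : IsManifold 𝓘(ℝ, F) 2 M := .of_le (n := ∞) two_le_infty
  choose j hj using h.exists_tangentIncl_eq_proj
  have hinj := tangentIncl_injective h.immersion
  let nabla : CovariantDerivative 𝓘(ℝ, F) F (fun x : M ↦ TangentSpace 𝓘(ℝ, F) x) :=
    { toFun := fun Y x ↦ j x ∘L ambientConnection F ι ΓE (fieldIncl F ι Y) x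
      isCovariantDerivativeOnUniv := by
        refine ⟨fun {Y Y' x} hY hY' _ ↦ ?_, fun {Y f x} hY hf _ ↦ ?_⟩
        · ext ξ
          apply hinj x
          simp only [ContinuousLinearMap.comp_apply, add_apply, map_add, hj]
          have h1 := mvfderiv_add (I := 𝓘(ℝ, F)) (h.mdifferentiableAt_fieldIncl hY)
            (h.mdifferentiableAt_fieldIncl hY')
          have h2 : fieldIncl F ι (Y + Y') = fieldIncl F ι Y + fieldIncl F ι Y' := by
            ext y; simp [fieldIncl]
          rw [← map_add, ambientConnection_apply, ambientConnection_apply, ambientConnection_apply,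
            h2, h1]
          congr 1
          simp only [add_apply, Pi.add_apply, map_add]
          abel
        · ext ξ
          apply hinj x
          have h1 := mvfderiv_smul (I := 𝓘(ℝ, F)) hf (h.mdifferentiableAt_fieldIncl hY)
          have h2 : fieldIncl F ι (f • Y) = f • fieldIncl F ι Y := by
            ext y; simp [fieldIncl]
          simp only [ContinuousLinearMap.comp_apply, add_apply, smul_apply,
            ContinuousLinearMap.smulRight_apply, map_add, map_smul, hj]
          have h3 : (ambientConnection F ι ΓE (fieldIncl F ι (f • Y)) x ξ : E) =
              ambientConnection F ι ΓE (fieldIncl F ι Y) x (f x • ξ) +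
                mvfderiv 𝓘(ℝ, F) f x ξ • tangentIncl F ι x (Y x) := by
            rw [ambientConnection_apply, ambientConnection_apply, h2, h1]
            simp only [add_apply, smul_apply, ContinuousLinearMap.smulRight_apply, Pi.smul_apply',
              map_smul, fieldIncl]
            abel
          refine (congrArg (proj F ι g x) h3).trans ?_
          -- The term `(D_ξ f) Y` is tangent, so the projection preserves the Leibniz rule.
          rw [map_add, map_smul (proj F ι g x), proj_tangentIncl h.posDef]
          congr 1
          exact (congrArg (proj F ι g x) (map_smul (ambientConnection F ι ΓE (fieldIncl F ι Y) x)
            (f x) ξ)).trans (map_smul (proj F ι g x) _ _) }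
  have hnabla : ∀ (Y : Π x : M, TangentSpace 𝓘(ℝ, F) x) (x : M) (ξ : TangentSpace 𝓘(ℝ, F) x),
      tangentIncl F ι x (nabla Y x ξ) =
        proj F ι g x (ambientConnection F ι ΓE (fieldIncl F ι Y) x ξ) :=
    fun Y x ξ ↦ hj x _
  refine ⟨nabla, ⟨?_, fun X Y Z x hY hZ ↦ ?_⟩, hnabla⟩
  · rw [nabla.torsion_eq_zero_iff]
    intro X Y x hX hY
    apply hinj x
    rw [map_sub, hnabla, hnabla, ← map_sub, h.ambientConnection_torsion hX hY,
      proj_tangentIncl h.posDef]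
  · have h1 := h.ambientConnection_metric hY (h.mdifferentiableAt_fieldIncl hZ) (X x)
    have h2 : (fun y ↦ (inner ℝ (Y y) (Z y) : ℝ)) =
        fun y ↦ inner ℝ (fieldIncl F ι Y y) (g y (fieldIncl F ι Z y)) :=
      funext fun y ↦ hg.metric y (Y y) (Z y)
    rw [h2, h1, hg.metric, hg.metric, hnabla, hnabla, inner_proj_left h.posDef,
      proj_tangentIncl h.posDef, ← inner_proj_left h.posDef, proj_tangentIncl h.posDef]
    rfl

end IsMetricChristoffel

end

/-! ### Christoffel function, curvature of `∇^E`, and Gauss–Codazzi -/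

section

variable {F : Type*} [NormedAddCommGroup F] [NormedSpace ℝ F] [FiniteDimensional ℝ F]
  {M : Type*} [TopologicalSpace M] [ChartedSpace F M] [IsManifold 𝓘(ℝ, F) ∞ M]
  [RiemannianBundle (fun x : M ↦ TangentSpace 𝓘(ℝ, F) x)]
  {E : Type*} [NormedAddCommGroup E] [InnerProductSpace ℝ E] [FiniteDimensional ℝ E]
  {ι : M → E} {g : M → E →L[ℝ] E} {ΓE : M → E →L[ℝ] E →L[ℝ] E} {x : M}
  {nabla : CovariantDerivative 𝓘(ℝ, F) F (fun x : M ↦ TangentSpace 𝓘(ℝ, F) x)}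

namespace IsMetricChristoffel

/-- The Levi-Civita connection is `∇_ξ Y = Π ∇^E_ξ Y`. -/
theorem tangentIncl_leviCivita (h : IsMetricChristoffel F ι g ΓE) (hg : IsAmbientStructure F ι g)
    (hL : IsLeviCivita F nabla) {Y : Π x : M, TangentSpace 𝓘(ℝ, F) x} (hY : MDiffAt (T% Y) x)
    (ξ : TangentSpace 𝓘(ℝ, F) x) :
    tangentIncl F ι x (nabla Y x ξ) =
      proj F ι g x (ambientConnection F ι ΓE (fieldIncl F ι Y) x ξ) := by
  obtain ⟨nabla', hL', h'⟩ := h.exists_isLeviCivita hg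
  rw [hL.eq hL' hY, h']

/-- Differentiating `Π Y = Y` gives `Π D_ξ Y = D_ξ Y - (D_ξ Π) Y`. -/
theorem tangentIncl_leviCivita_eq (h : IsMetricChristoffel F ι g ΓE)
    (hg : IsAmbientStructure F ι g) (hL : IsLeviCivita F nabla)
    {Y : Π x : M, TangentSpace 𝓘(ℝ, F) x} (hY : MDiffAt (T% Y) x) (ξ : TangentSpace 𝓘(ℝ, F) x) :
    tangentIncl F ι x (nabla Y x ξ) =
      mvfderiv 𝓘(ℝ, F) (fieldIncl F ι Y) x ξ
        - mvfderiv 𝓘(ℝ, F) (proj F ι g) x ξ (fieldIncl F ι Y x)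
        + proj F ι g x (ΓE x (tangentIncl F ι x ξ) (fieldIncl F ι Y x)) := by
  rw [h.tangentIncl_leviCivita hg hL hY, ambientConnection_apply, map_add]
  nth_rw 2 [h.mvfderiv_fieldIncl hY]
  rw [add_sub_cancel_left]

theorem exists_isChristoffelFunction (h : IsMetricChristoffel F ι g ΓE)
    (hg : IsAmbientStructure F ι g) (hL : IsLeviCivita F nabla) :
    ∃ Γ : M → E →L[ℝ] E →L[ℝ] E, IsChristoffelFunction F ι nabla Γ ∧
      ∀ (x : M) (ξ : TangentSpace 𝓘(ℝ, F) x) (w : E),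
        Γ x (tangentIncl F ι x ξ) w = tangentChristoffel F ι g ΓE x ξ w := by
  choose j hj using h.exists_tangentIncl_eq_proj
  have hP := proj_contMDiff h.immersion h.smooth_metric h.posDef
  -- The extension precomposes the first argument with `Π`, through `j` in the term that
  -- differentiates `Π`.
  let Γ : M → E →L[ℝ] E →L[ℝ] E := fun x ↦ -(mvfderiv 𝓘(ℝ, F) (proj F ι g) x ∘L j x) +
    (proj F ι g x).postcomp E ∘L ΓE x ∘L proj F ι g x
  have hΓ : ∀ (x : M) (ξ : TangentSpace 𝓘(ℝ, F) x) (w : E),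
      Γ x (tangentIncl F ι x ξ) w = tangentChristoffel F ι g ΓE x ξ w := by
    intro x ξ w
    have h1 : j x (tangentIncl F ι x ξ) = ξ :=
      tangentIncl_injective h.immersion x (by rw [hj, proj_tangentIncl h.posDef])
    simp [Γ, tangentChristoffel, h1, proj_tangentIncl h.posDef]
  refine ⟨Γ, ⟨fun x ↦ ?_, fun X Y x hY ↦ ?_⟩, hΓ⟩
  · obtain ⟨r, hr⟩ := exists_isRetractionAt h.immersion x
    -- No smoothness of `j` is needed: near `x`, the composite of `DΠ` with `j` is the Fréchet
    -- derivative of `Π ∘ r` composed with `Π`.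
    have h1 : ContMDiffAt 𝓘(ℝ, F) 𝓘(ℝ, E →L[ℝ] E →L[ℝ] E) ∞
        (fun y ↦ fderiv ℝ (proj F ι g ∘ r) (ι y) ∘L proj F ι g y) x :=
      (hr.contMDiffAt_fderiv (hP x)).clm_comp (hP x)
    refine (h1.neg.add ((hP x).clm_postcomp.clm_comp ((h.smooth x).clm_comp (hP x)))).congr_of_eventuallyEq
      ?_
    filter_upwards [hr.eventually_one] with y hy
    have h2 : mvfderiv 𝓘(ℝ, F) (proj F ι g) y ∘L j y =
        fderiv ℝ (proj F ι g ∘ r) (ι y) ∘L proj F ι g y := by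
      ext v : 1
      rw [ContinuousLinearMap.comp_apply, hy.mvfderiv_eq (h.mdifferentiableAt_proj y), hj]
      rfl
    simp only [Γ, h2]
    rfl
  · rw [hΓ, h.tangentIncl_leviCivita_eq hg hL hY]
    simp only [tangentChristoffel, fieldIncl, add_apply, neg_apply, ContinuousLinearMap.comp_apply]
    abel

omit [FiniteDimensional ℝ F] [RiemannianBundle (fun x : M ↦ TangentSpace 𝓘(ℝ, F) x)]
  [FiniteDimensional ℝ E] in
theorem mdifferentiableAt_mvfderiv_apply {V : Type*} [NormedAddCommGroup V] [NormedSpace ℝ V]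
    (h : IsMetricChristoffel F ι g ΓE) {f : M → V} (hf : ContMDiffAt 𝓘(ℝ, F) 𝓘(ℝ, V) ∞ f x)
    {Y : Π x : M, TangentSpace 𝓘(ℝ, F) x} (hY : MDiffAt (T% Y) x) :
    MDifferentiableAt 𝓘(ℝ, F) 𝓘(ℝ, V) (fun y ↦ mvfderiv 𝓘(ℝ, F) f y (Y y)) x := by
  have : IsManifold 𝓘(ℝ, F) 1 M := .of_le (n := ∞) (by simp)
  obtain ⟨r, hr⟩ := exists_isRetractionAt h.immersion x
  have hf1 : ∀ᶠ y in 𝓝 x, ContMDiffAt 𝓘(ℝ, F) 𝓘(ℝ, V) 1 f y :=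
    (contMDiffAt_iff_contMDiffAt_nhds (by simp)).1 (hf.of_le (by simp))
  refine (mdifferentiableAt_clm_apply ((hr.contMDiffAt_fderiv hf).mdifferentiableAt (by simp))
    (h.mdifferentiableAt_fieldIncl hY)).congr_of_eventuallyEq ?_
  filter_upwards [hf1, hr.eventually_one] with y h2 h3
  exact h3.mvfderiv_eq (h2.mdifferentiableAt one_ne_zero) (Y y)

variable (F ι ΓE) in
/-- The function `∇^E_Y Z` to `E`, for tangent vector fields `Y`, `Z`. -/
noncomputable def ambientDeriv (Y Z : Π x : M, TangentSpace 𝓘(ℝ, F) x) (y : M) : E :=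
  mvfderiv 𝓘(ℝ, F) (fieldIncl F ι Z) y (Y y) + ΓE y (fieldIncl F ι Y y) (fieldIncl F ι Z y)

omit [FiniteDimensional ℝ F] [RiemannianBundle (fun x : M ↦ TangentSpace 𝓘(ℝ, F) x)]
  [FiniteDimensional ℝ E] in
theorem mdifferentiableAt_christoffel_apply (h : IsMetricChristoffel F ι g ΓE)
    {Y Z : Π x : M, TangentSpace 𝓘(ℝ, F) x} (hY : MDiffAt (T% Y) x) (hZ : MDiffAt (T% Z) x) :
    MDifferentiableAt 𝓘(ℝ, F) 𝓘(ℝ, E)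
      (fun y ↦ ΓE y (fieldIncl F ι Y y) (fieldIncl F ι Z y)) x :=
  mdifferentiableAt_clm_apply (mdifferentiableAt_clm_apply (h.mdifferentiableAt x)
    (h.mdifferentiableAt_fieldIncl hY)) (h.mdifferentiableAt_fieldIncl hZ)

omit [FiniteDimensional ℝ F] [RiemannianBundle (fun x : M ↦ TangentSpace 𝓘(ℝ, F) x)]
  [FiniteDimensional ℝ E] in
theorem mdifferentiableAt_ambientDeriv (h : IsMetricChristoffel F ι g ΓE)
    {Y Z : Π x : M, TangentSpace 𝓘(ℝ, F) x} (hY : MDiffAt (T% Y) x) (hZ : CMDiffAt ∞ (T% Z) x) :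
    MDifferentiableAt 𝓘(ℝ, F) 𝓘(ℝ, E) (ambientDeriv F ι ΓE Y Z) x :=
  (h.mdifferentiableAt_mvfderiv_apply (contMDiffAt_fieldIncl h.immersion.contMDiff hZ) hY).add
    (h.mdifferentiableAt_christoffel_apply hY (hZ.mdifferentiableAt (by simp)))

omit [RiemannianBundle (fun x : M ↦ TangentSpace 𝓘(ℝ, F) x)] [FiniteDimensional ℝ E] in
/-- The curvature of the connection `∇^E`. -/
theorem ambientCurvature_eq (h : IsMetricChristoffel F ι g ΓE)
    {X Y Z : Π x : M, TangentSpace 𝓘(ℝ, F) x} (hX : MDiffAt (T% X) x) (hY : MDiffAt (T% Y) x)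
    (hZ : CMDiffAt ∞ (T% Z) x) :
    (ambientConnection F ι ΓE (fieldIncl F ι Z) x (VectorField.mlieBracket 𝓘(ℝ, F) X Y x) : E)
      - ambientConnection F ι ΓE (ambientDeriv F ι ΓE Y Z) x (X x)
      + ambientConnection F ι ΓE (ambientDeriv F ι ΓE X Z) x (Y x) =
        ambientCurvature F ι ΓE x (X x) (Y x) (Z x) := by
  have := FiniteDimensional.complete ℝ F
  have hZd : MDiffAt (T% Z) x := hZ.mdifferentiableAt (by simp)
  have hZs := contMDiffAt_fieldIncl h.immersion.contMDiff hZ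
  have hder : ∀ {X Y : Π x : M, TangentSpace 𝓘(ℝ, F) x}, MDiffAt (T% Y) x →
      mvfderiv 𝓘(ℝ, F) (ambientDeriv F ι ΓE Y Z) x (X x) =
        mvfderiv 𝓘(ℝ, F) (fun y ↦ mvfderiv 𝓘(ℝ, F) (fieldIncl F ι Z) y (Y y)) x (X x) +
          (mvfderiv 𝓘(ℝ, F) ΓE x (X x) (fieldIncl F ι Y x) (fieldIncl F ι Z x) +
            ΓE x (mvfderiv 𝓘(ℝ, F) (fieldIncl F ι Y) x (X x)) (fieldIncl F ι Z x) +
            ΓE x (fieldIncl F ι Y x) (mvfderiv 𝓘(ℝ, F) (fieldIncl F ι Z) x (X x))) := by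
    intro X Y hY
    have hY' := h.mdifferentiableAt_fieldIncl hY
    have hZ' := h.mdifferentiableAt_fieldIncl hZd
    have h1 := mvfderiv_add (I := 𝓘(ℝ, F)) (h.mdifferentiableAt_mvfderiv_apply hZs hY)
      (h.mdifferentiableAt_christoffel_apply hY hZd)
    have h2 := congrArg (fun L : TangentSpace 𝓘(ℝ, F) x →L[ℝ] E ↦ L (X x)) h1
    refine Eq.trans h2 ?_
    simp only [add_apply]
    rw [mvfderiv_clm_apply (mdifferentiableAt_clm_apply (h.mdifferentiableAt x) hY') hZ',
      mvfderiv_clm_apply (h.mdifferentiableAt x) hY', add_apply]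
  -- The second derivatives of `Z` cancel against `D_{[X,Y]} Z`, and the terms with `D_X Y - D_Y X`
  -- cancel against `Γ^E([X, Y], Z)`.
  rw [ambientConnection_apply, ambientConnection_apply, ambientConnection_apply, hder hX, hder hY,
    mvfderiv_mlieBracket h.immersion hX hY hZs, tangentIncl_mlieBracket h.immersion hX hY]
  simp only [ambientDeriv, ambientCurvature, fieldIncl, map_add, map_sub, sub_apply]
  abel

/-- The tangential component of an iterated ambient derivative. -/
theorem tangentIncl_leviCivita_leviCivita (h : IsMetricChristoffel F ι g ΓE)
    (hg : IsAmbientStructure F ι g) (hL : IsLeviCivita F nabla)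
    {Y Z : Π x : M, TangentSpace 𝓘(ℝ, F) x} (hY : MDiffAt (T% Y) x) (hZ : CMDiffAt ∞ (T% Z) x)
    (ξ : TangentSpace 𝓘(ℝ, F) x) :
    tangentIncl F ι x (nabla (fun y ↦ nabla Z y (Y y)) x ξ) =
      proj F ι g x (ambientConnection F ι ΓE (ambientDeriv F ι ΓE Y Z) x ξ) +
        tangentIncl F ι x
          (secondFormAdjoint F ι g ΓE x ξ (secondForm F ι g ΓE x (Y x) (Z x))) := by
  have : IsManifold 𝓘(ℝ, F) 1 M := .of_le (n := ∞) (by simp)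
  have hZs := contMDiffAt_fieldIncl h.immersion.contMDiff hZ
  have hZ1 : ∀ᶠ y in 𝓝 x, ContMDiffAt 𝓘(ℝ, F) 𝓘(ℝ, E) 1 (fieldIncl F ι Z) y :=
    (contMDiffAt_iff_contMDiffAt_nhds (by simp)).1 (hZs.of_le (by simp))
  have hS := h.mdifferentiableAt_ambientDeriv hY hZ
  have hP := h.mdifferentiableAt_proj x
  set S := ambientDeriv F ι ΓE Y Z
  -- Smoothness of `Z` at `x` makes it differentiable at all nearby points, so `∇_Y Z = Π S` holds
  -- near `x` and can be differentiated.
  have hloc : fieldIncl F ι (fun y ↦ nabla Z y (Y y)) =ᶠ[𝓝 x] fun y ↦ proj F ι g y (S y) := by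
    filter_upwards [hZ1] with y hy
    exact h.tangentIncl_leviCivita hg hL
      (mdifferentiableAt_of_fieldIncl h.immersion (hy.mdifferentiableAt one_ne_zero)) (Y y)
  have hPS := mdifferentiableAt_clm_apply hP hS
  have hN : MDiffAt (T% (fun y ↦ nabla Z y (Y y))) x :=
    mdifferentiableAt_of_fieldIncl h.immersion (hPS.congr_of_eventuallyEq hloc)
  have hII : S x - proj F ι g x (S x) = secondForm F ι g ΓE x (Y x) (Z x) :=
    h.ambientConnection_sub_proj (hZ.mdifferentiableAt (by simp)) (Y x)
  have hPII := h.proj_secondForm x (Y x) (Z x)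
  set II := secondForm F ι g ΓE x (Y x) (Z x)
  rw [h.tangentIncl_leviCivita hg hL hN, h.tangentIncl_secondFormAdjoint hg, hPII, sub_zero,
    ambientConnection_apply, ambientConnection_apply, mvfderiv_congr hloc, hloc.self_of_nhds,
    mvfderiv_clm_apply hP hS]
  -- `S` is its tangent part plus `II`; `D_ξ Π` sends the former to a normal vector, killed by `Π`,
  -- and the latter to a tangent vector. With `Π S = S - II` in the Christoffel term, the excess
  -- over `Π ∇^E_ξ S` is `(D_ξ Π) II - Π Γ^E(ξ, II) = -Γ(ξ, II)`, which is `II†_ξ II`.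
  have h1 : proj F ι g x (mvfderiv 𝓘(ℝ, F) (proj F ι g) x ξ (S x)) =
      mvfderiv 𝓘(ℝ, F) (proj F ι g) x ξ II := by
    obtain ⟨ζ, hζ⟩ := proj_mem (F := F) ι g x (S x)
    rw [← h.proj_mvfderiv_proj_of_proj_eq_zero x ξ hPII, ← hII, ← hζ, map_sub, map_sub,
      h.proj_mvfderiv_proj_tangentIncl, sub_zero]
  have h2 : proj F ι g x (S x) = S x - II := by rw [← hII]; abel
  simp only [map_add, h1, h2, map_sub, proj_idem h.posDef, tangentChristoffel, add_apply, neg_apply,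
    ContinuousLinearMap.comp_apply]
  abel

/-- The Gauss-Codazzi equation. -/
theorem tangentIncl_curvature (h : IsMetricChristoffel F ι g ΓE)
    (hg : IsAmbientStructure F ι g) (hL : IsLeviCivita F nabla)
    {X Y Z : Π x : M, TangentSpace 𝓘(ℝ, F) x} (hX : MDiffAt (T% X) x) (hY : MDiffAt (T% Y) x)
    (hZ : CMDiffAt ∞ (T% Z) x) :
    tangentIncl F ι x (curvature F nabla X Y Z x) =
      proj F ι g x (ambientCurvature F ι ΓE x (X x) (Y x) (Z x))
        + tangentIncl F ι x
            (secondFormAdjoint F ι g ΓE x (Y x) (secondForm F ι g ΓE x (X x) (Z x)))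
        - tangentIncl F ι x
            (secondFormAdjoint F ι g ΓE x (X x) (secondForm F ι g ΓE x (Y x) (Z x))) := by
  rw [← h.ambientCurvature_eq hX hY hZ, curvature, map_add, map_sub,
    h.tangentIncl_leviCivita hg hL (hZ.mdifferentiableAt (by simp)),
    h.tangentIncl_leviCivita_leviCivita hg hL hY hZ,
    h.tangentIncl_leviCivita_leviCivita hg hL hX hZ, map_add, map_sub]
  abel

end IsMetricChristoffel

end

end EmbeddedAmbient

/-! ### The theorem -/

open EmbeddedAmbient in
theorem mainTheorem4 {F : Type*} [NormedAddCommGroup F] [NormedSpace ℝ F] [FiniteDimensional ℝ F]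
    {M : Type*} [TopologicalSpace M] [ChartedSpace F M] [IsManifold 𝓘(ℝ, F) ∞ M]
    [RiemannianBundle (fun x : M ↦ TangentSpace 𝓘(ℝ, F) x)]
    {E : Type*} [NormedAddCommGroup E] [InnerProductSpace ℝ E] [FiniteDimensional ℝ E]
    (ι : M → E) (g : M → E →L[ℝ] E) (hg : IsAmbientStructure F ι g)
    (ΓE : M → E →L[ℝ] E →L[ℝ] E)
    (hsmooth : ContMDiff 𝓘(ℝ, F) 𝓘(ℝ, E →L[ℝ] E →L[ℝ] E) ∞ ΓE)
    (hsymm : ∀ (x : M) (ξ η : TangentSpace 𝓘(ℝ, F) x),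
      ΓE x (tangentIncl F ι x ξ) (tangentIncl F ι x η) =
        ΓE x (tangentIncl F ι x η) (tangentIncl F ι x ξ))
    (hmetric : ∀ (x : M) (ξ η : TangentSpace 𝓘(ℝ, F) x) (w : E),
      inner ℝ (tangentIncl F ι x η) (mvfderiv 𝓘(ℝ, F) g x ξ w) =
        inner ℝ (ΓE x (tangentIncl F ι x ξ) (tangentIncl F ι x η)) (g x w) +
          inner ℝ (tangentIncl F ι x η) (g x (ΓE x (tangentIncl F ι x ξ) w))) :
    -- `∇^E_X Y - ∇^E_Y X = [X, Y]`
    (∀ (X Y : Π x : M, TangentSpace 𝓘(ℝ, F) x) (x : M), MDiffAt (T% X) x → MDiffAt (T% Y) x →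
      ambientConnection F ι ΓE (fieldIncl F ι Y) x (X x) -
          ambientConnection F ι ΓE (fieldIncl F ι X) x (Y x) =
        tangentIncl F ι x (VectorField.mlieBracket 𝓘(ℝ, F) X Y x)) ∧
    -- `D_X ⟪Y, g s⟫ = ⟪∇^E_X Y, g s⟫ + ⟪Y, g ∇^E_X s⟫`
    (∀ (X Y : Π x : M, TangentSpace 𝓘(ℝ, F) x) (s : M → E) (x : M),
      MDiffAt (T% Y) x → MDifferentiableAt 𝓘(ℝ, F) 𝓘(ℝ, E) s x →
      mvfderiv 𝓘(ℝ, F) (fun y ↦ (inner ℝ (fieldIncl F ι Y y) (g y (s y)) : ℝ)) x (X x) =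
        inner ℝ (ambientConnection F ι ΓE (fieldIncl F ι Y) x (X x) : E) (g x (s x)) +
          inner ℝ (fieldIncl F ι Y x) (g x (ambientConnection F ι ΓE s x (X x)))) ∧
    -- the Levi-Civita connection of `M` exists
    (∃ nabla : CovariantDerivative 𝓘(ℝ, F) F (fun x : M ↦ TangentSpace 𝓘(ℝ, F) x),
      IsLeviCivita F nabla) ∧
    (∀ nabla : CovariantDerivative 𝓘(ℝ, F) F (fun x : M ↦ TangentSpace 𝓘(ℝ, F) x),
      IsLeviCivita F nabla →
      -- `-(D_ξ Π) ω + Π Γ^E(ξ, ω)` extends to a Christoffel function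
      (∃ Γ : M → E →L[ℝ] E →L[ℝ] E, IsChristoffelFunction F ι nabla Γ ∧
        ∀ (x : M) (ξ : TangentSpace 𝓘(ℝ, F) x) (w : E),
          Γ x (tangentIncl F ι x ξ) w = tangentChristoffel F ι g ΓE x ξ w) ∧
      -- `∇_X Y = D_X Y - (D_X Π) Y + Π Γ^E(X, Y)`
      (∀ (X Y : Π x : M, TangentSpace 𝓘(ℝ, F) x) (x : M), MDiffAt (T% Y) x →
        tangentIncl F ι x (nabla Y x (X x)) =
          mvfderiv 𝓘(ℝ, F) (fieldIncl F ι Y) x (X x)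
            - mvfderiv 𝓘(ℝ, F) (proj F ι g) x (X x) (fieldIncl F ι Y x)
            + proj F ι g x (ΓE x (fieldIncl F ι X x) (fieldIncl F ι Y x))) ∧
      -- Gauss-Codazzi: `R^M_{ξη} φ = Π R^E_{ξη} φ + II†(η, II(ξ, φ)) - II†(ξ, II(η, φ))`
      -- with `ξ = X x`, `η = Y x`, `φ = Z x`
      (∀ (X Y Z : Π x : M, TangentSpace 𝓘(ℝ, F) x) (x : M),
        CMDiffAt ∞ (T% X) x → CMDiffAt ∞ (T% Y) x → CMDiffAt ∞ (T% Z) x →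
        tangentIncl F ι x (curvature F nabla X Y Z x) =
          proj F ι g x (ambientCurvature F ι ΓE x (X x) (Y x) (Z x))
            + tangentIncl F ι x
                (secondFormAdjoint F ι g ΓE x (Y x) (secondForm F ι g ΓE x (X x) (Z x)))
            - tangentIncl F ι x
                (secondFormAdjoint F ι g ΓE x (X x) (secondForm F ι g ΓE x (Y x) (Z x))))) ∧
    -- the second fundamental form: its two expressions, symmetry, normality
    (∀ (x : M) (ξ η : TangentSpace 𝓘(ℝ, F) x),
      secondForm F ι g ΓE x ξ η =
          mvfderiv 𝓘(ℝ, F) (proj F ι g) x ξ (tangentIncl F ι x η) +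
            (ContinuousLinearMap.id ℝ E - proj F ι g x)
              (ΓE x (tangentIncl F ι x ξ) (tangentIncl F ι x η)) ∧
        secondForm F ι g ΓE x ξ η = secondForm F ι g ΓE x η ξ ∧
        proj F ι g x (secondForm F ι g ΓE x ξ η) = 0) ∧
    -- the adjoint: `II†_ξ ω = (D_ξ Π)(I - Π) ω - Π Γ^E(ξ, (I - Π) ω) = -Γ(ξ, (I - Π) ω)`
    (∀ (x : M) (ξ : TangentSpace 𝓘(ℝ, F) x) (w : E),
      tangentIncl F ι x (secondFormAdjoint F ι g ΓE x ξ w) =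
          mvfderiv 𝓘(ℝ, F) (proj F ι g) x ξ (w - proj F ι g x w) -
            proj F ι g x (ΓE x (tangentIncl F ι x ξ) (w - proj F ι g x w)) ∧
        tangentIncl F ι x (secondFormAdjoint F ι g ΓE x ξ w) =
          -tangentChristoffel F ι g ΓE x ξ (w - proj F ι g x w)) := by
  have h : IsMetricChristoffel F ι g ΓE :=
    ⟨hg.embedding.isImmersion, hg.smooth, hg.posDef, hsmooth, hsymm, hmetric⟩
  refine ⟨fun X Y x hX hY ↦ ?_, fun X Y s x hY hs ↦ h.ambientConnection_metric hY hs (X x), ?_,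
    fun nabla hL ↦ ⟨h.exists_isChristoffelFunction hg hL,
      fun X Y x hY ↦ h.tangentIncl_leviCivita_eq hg hL hY (X x),
      fun X Y Z x hX hY hZ ↦ h.tangentIncl_curvature hg hL (hX.mdifferentiableAt (by simp))
        (hY.mdifferentiableAt (by simp)) hZ⟩,
    fun x ξ η ↦ ⟨IsMetricChristoffel.secondForm_apply x ξ η, h.secondForm_symm x ξ η,
      h.proj_secondForm x ξ η⟩,
    fun x ξ w ↦ ⟨?_, h.tangentIncl_secondFormAdjoint hg ξ w⟩⟩
  · have := FiniteDimensional.complete ℝ F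
    exact h.ambientConnection_torsion hX hY
  · obtain ⟨nabla, hL, -⟩ := h.exists_isLeviCivita hg
    exact ⟨nabla, hL⟩
  · rw [h.tangentIncl_secondFormAdjoint hg]
    simp only [tangentChristoffel, add_apply, neg_apply, ContinuousLinearMap.comp_apply]
    abel
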